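/- **Setting.** Let $V$ be a set of $n$ nodes and let $p_{uv}\in[0,1]$ ($u,v\in V$) be edge probabilities ($p_{uv}=0$ means that there is no edge from $u$ to $v$). In the independent cascade (IC) model with seed set $S_0$ (put $S_{-1}=\emptyset$), at each step $\tau\ge 1$ the set $S_\tau\supseteq S_{\tau-1}$ is obtained by adding each $v\notin S_{\tau-1}$ independently with probability $1-\prod_{u\in S_{\tau-1}\setminus S_{\tau-2}}(1-p_{uv})$. A cascade is the sequence $(S_0,\dots,S_{n-1})$, and $\sigma(S)=\sigma^p(S)=\mathbb E\big[|S_{n-1}|\,\big|\,S_0=S\big]$ is the influence spread. For $\kappa\in(0,1]$, a $\kappa$-approximation algorithm for influence maximization is a map $A$ which, for all edge probabilities $\hat p$ on $V$ and every integer $1\le m\le n$, returns a set $A(\hat p,m)$ with $|A(\hat p,m)|\le m$ and $\sigma^{\hat p}(A(\hat p,m))\ge\kappa\,\sigma^{\hat p}(T)$ for all $T\subseteq V$ with $|T|\le m$. **Algorithm.** The input is $t$ cascades $(S_{i,0},\dots,S_{i,n-1})_{i=1}^t$, $k$, $\varepsilon$, $\delta$, and $t'$. 1. For each $v$ let $\widehat{\mathrm{ap}}'(v)$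 be the fraction of the first $t'$ cascades with $v\in S_{i,1}$, and let $V_2=\{v:\widehat{\mathrm{ap}}'(v)\ge 1-\delta/(4n)\}$. Set $\hat p_{uv}=1$ for all $u\in V$, $v\in V_2$. 2. From the cascades $i=t'+1,\dots,t$ compute, for $u\in V$ and $v\in V\setminus V_2$, the fraction $\hat q_u$ of cascades with $u\in S_{i,0}$, the fraction $\widehat{\mathrm{ap}}(v)$ with $v\in S_{i,1}$, and the fraction $\widehat{\mathrm{ap}}(v\mid\bar u)$ with $v\in S_{i,1}$ among those with $u\notin S_{i,0}$. Set $$\hat p_{uv}=\frac{\widehat{\mathrm{ap}}(v)-\widehat{\mathrm{ap}}(v\mid\bar u)}{\hat q_u\,(1-\widehat{\mathrm{ap}}(v\mid\bar u))},$$ truncated to $[0,1]$ (and $0$ if a denominator vanishes; if no cascade has $u\notin S_{i,0}$, put $\widehat{\mathrm{ap}}(v\mid\bar u)=0$). 3. Let $T_1=A(\hat p,\lfloor(1-2\varepsilon)k\rfloor)$ and $T_2=S_{1,0}$. Return $S^A=T_1\cup T_2$. **Theorem.** Let $1\le k\le n$ be an integer, $\varepsilon\in(0,1/3)$, $\gamma\in(0,1/2]$,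 $\delta\in(0,1)$, $\kappa\in(0,1]$, and let $A$ be a $\kappa$-approximation algorithm for influence maximization. Let the $t$ cascades be independent, where each seed set $S_{i,0}$ contains each $u\in V$ independently with probability $q_u$ and the rest of the cascade follows the IC model with probabilities $p$. Suppose that $$\sum_{u\in V}q_u\le\varepsilon k,\qquad \gamma\le q_u\le 1-\gamma\ \text{ for all } u\in V,\qquad k\ge\frac3\varepsilon\ln\frac3\delta,$$ $$t\ \ge\ \frac{36864}{\varepsilon^2\delta^2\gamma^3}\,\frac{n^8}{k^2}\,\ln\frac{36n}{\delta}+\frac{72n^2}{\delta^2}\ln\frac{12n}{\delta},\qquad t'=\Big\lceil\frac{72n^2}{\delta^2}\ln\frac{12n}{\delta}\Big\rceil .$$ Let $S^*$ maximize $\sigma$ over all sets of at most $k$ nodes. Then $$\Pr\big[\,|S^A|\le k\ \text{ and }\ \sigma(S^A)\ge(\kappa-3\varepsilon)\,\sigma(S^*)\,\big]\ \ge\ 1-\delta,$$ where the probability is over the $t$ cascades. -/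

import Mathlib

open MeasureTheory ProbabilityTheory

noncomputable section

namespace InfluenceMax

variable {V : Type*} [Fintype V] [DecidableEq V]

/-- A social network on the node set `V`: the probability `p u v` of the edge `(u, v)` for all
ordered pairs. The edge set is `{(u, v) | p u v > 0}`, so a non-edge is a pair with `p u v = 0`. -/
abbrev Network (V : Type*) := V → V → unitInterval

/-- A sequence `S₀, S₁, S₂, …` of sets of active nodes. -/
abbrev Cascade (V : Type*) := ℕ → Finset V

/-- The probability that the random set which contains each `v` independently with probability
`a v` equals `S`. -/
def subsetWeight (a : V → unitInterval) (S : Finset V) : ENNReal :=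
  ENNReal.ofReal ((∏ v ∈ S, (a v : ℝ)) * ∏ v ∈ Sᶜ, (1 - (a v : ℝ)))

theorem sum_subsetWeight (a : V → unitInterval) : ∑ S, subsetWeight a S = 1 := by
  unfold subsetWeight
  rw [← ENNReal.ofReal_sum_of_nonneg]
  · have h := Finset.prod_add (fun v => (a v : ℝ)) (fun v => 1 - (a v : ℝ)) Finset.univ
    simp only [add_sub_cancel, Finset.prod_const_one, Finset.powerset_univ,
      ← Finset.compl_eq_univ_sdiff] at h
    rw [← h, ENNReal.ofReal_one]
  · intro S _
    exact mul_nonneg (Finset.prod_nonneg fun v _ => (a v).2.1)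
      (Finset.prod_nonneg fun v _ => sub_nonneg.2 (a v).2.2)

/-- The product distribution on node sets: each `v` is drawn independently with probability
`a v`. -/
def randomSubset (a : V → unitInterval) : PMF (Finset V) :=
  PMF.ofFintype (subsetWeight a) (sum_subsetWeight a)

/-- The nodes that became active exactly at step `τ`: `S_τ \ S_{τ-1}`, where `S_{-1} = ∅`. -/
def newlyActive (c : Cascade V) : ℕ → Finset V
  | 0 => c 0
  | τ + 1 => c (τ + 1) \ c τ

/-- The probability `1 - ∏_{u ∈ new} (1 - p u v)` that at least one of the independent
activation attempts from the nodes of `new` on `v` succeeds. -/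
def activationProb (p : Network V) (new : Finset V) (v : V) : unitInterval :=
  unitInterval.symm (∏ u ∈ new, unitInterval.symm (p u v))

/-- One step of the independent cascade (IC) model: the law of `S_{τ+1}` given `S_0, …, S_τ`.
Active nodes stay active and, independently, each inactive node `v` is activated with probability
`activationProb p (S_τ \ S_{τ-1}) v`. -/
def icStep (p : Network V) (c : Cascade V) (τ : ℕ) : PMF (Finset V) :=
  (randomSubset (activationProb p (newlyActive c τ))).map fun A => c τ ∪ A

/-- The law of the first `m` steps of the IC diffusion started at the seed set `S`; the sequence is
continued as a constant after step `m`. -/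
def icSteps (p : Network V) (S : Finset V) : ℕ → PMF (Cascade V)
  | 0 => PMF.pure fun _ => S
  | m + 1 => (icSteps p S m).bind fun c =>
      (icStep p c m).map fun A => fun j => if j ≤ m then c j else A

/-- The law of the cascade `S_0, …, S_{n-1}` with seed set `S_0 = S`, where `n` is the number of
nodes. The diffusion has ended by step `n - 1`, so `S_τ = S_{n-1}` for `τ ≥ n`. -/
def icCascade (p : Network V) (S : Finset V) : PMF (Cascade V) :=
  icSteps p S (Fintype.card V - 1)

/-- The law of a cascade whose seed set is drawn from the product distribution with marginals
`q`. -/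
def cascadeLaw (p : Network V) (q : V → unitInterval) : PMF (Cascade V) :=
  (randomSubset q).bind (icCascade p)

/-- The influence spread `σ^p(S)`: the expected size of the final active set `S_{n-1}`. -/
def spread (p : Network V) (S : Finset V) : ℝ :=
  ∑ A : Finset V,
    ((icCascade p S).map (fun c => c (Fintype.card V - 1)) A).toReal * (A.card : ℝ)

/-- `S` is an optimal solution of influence maximization on `p` with budget `k`. -/
def IsOptimalSeedSet (p : Network V) (k : ℕ) (S : Finset V) : Prop :=
  S.card ≤ k ∧ ∀ T : Finset V, T.card ≤ k → spread p T ≤ spread p S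

/-- `A` is a `κ`-approximation algorithm for influence maximization on the node set `V`: on every
network and for every budget `1 ≤ k ≤ n` it returns at most `k` seeds whose influence spread is at
least `κ` times that of any set of at most `k` seeds. -/
def IsApproxAlgorithm (κ : ℝ) (A : Network V → ℕ → Finset V) : Prop :=
  ∀ (p : Network V) (k : ℕ), 1 ≤ k → k ≤ Fintype.card V →
    (A p k).card ≤ k ∧ ∀ T : Finset V, T.card ≤ k → κ * spread p T ≤ spread p (A p k)

/-- The assumption on the seed distribution, with parameters `c` and `γ`. -/
def SeedAssumption (q : V → unitInterval) (k : ℕ) (c γ : ℝ) : Prop :=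
  (∑ u, (q u : ℝ)) ≤ c * k ∧ ∀ u, γ ≤ (q u : ℝ) ∧ (q u : ℝ) ≤ 1 - γ

section Algorithm

variable {t : ℕ}

/-- `q̂_u`: the fraction of the cascades with index in `I` in which `u` is a seed. -/
def seedEstimate (c : Fin t → Cascade V) (I : Finset (Fin t)) (u : V) : ℝ :=
  ((I.filter fun i => u ∈ c i 0).card : ℝ) / (I.card : ℝ)

/-- `âp(v)`: the fraction of the cascades with index in `I` in which `v` is active after one
step. -/
def apEstimate (c : Fin t → Cascade V) (I : Finset (Fin t)) (v : V) : ℝ :=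
  ((I.filter fun i => v ∈ c i 1).card : ℝ) / (I.card : ℝ)

/-- `âp(v | ū)`: among the cascades with index in `I` in which `u` is not a seed, the fraction of
those in which `v` is active after one step. -/
def apCondEstimate (c : Fin t → Cascade V) (I : Finset (Fin t)) (v u : V) : ℝ :=
  ((I.filter fun i => u ∉ c i 0 ∧ v ∈ c i 1).card : ℝ) /
    ((I.filter fun i => u ∉ c i 0).card : ℝ)

/-- The estimate of `p u v` from the cascades with index in `I`. -/
def edgeEstimate (c : Fin t → Cascade V) (I : Finset (Fin t)) (u v : V) : ℝ :=
  (apEstimate c I v - apCondEstimate c I v u) /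
    (seedEstimate c I u * (1 - apCondEstimate c I v u))

/-- The learned network `Ĝ`. If the estimate of `ap(v)` from the first `t'` cascades is at least
`1 - δ / (4 n)`, all edges into `v` get probability `1`; the probabilities of the edges into the
other nodes are estimated from the remaining cascades, and truncated to `[0, 1]` since the raw
estimates may leave this interval. -/
def learnedNetwork (c : Fin t → Cascade V) (t' : ℕ) (δ : ℝ) : Network V := fun u v =>
  if 1 - δ / (4 * (Fintype.card V : ℝ)) ≤
      apEstimate c (Finset.univ.filter fun i => (i : ℕ) < t') v then 1
  else Set.projIcc (0 : ℝ) 1 zero_le_one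
    (edgeEstimate c (Finset.univ.filter fun i => t' ≤ (i : ℕ)) u v)

/-- The output `T₁ ∪ T₂` of the algorithm: `T₁` is the output of `A` on the learned network with
budget `(1 - 2 ε) k` (rounded down), and `T₂` is the seed set of the first cascade. -/
def imsOutput [NeZero t] (A : Network V → ℕ → Finset V) (c : Fin t → Cascade V) (t' k : ℕ)
    (ε δ : ℝ) : Finset V :=
  A (learnedNetwork c t' δ) ⌊(1 - 2 * ε) * (k : ℝ)⌋₊ ∪ c 0 0

end Algorithm

end InfluenceMax

end

open InfluenceMax

open MeasureTheory ProbabilityTheory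

set_option linter.unusedSectionVars false

noncomputable section

/-! Attach an independent uniform variable to each ordered pair of nodes; the pair is live if the
variable lies below its probability. The diffusion is then a breadth first search that inspects each
edge at most once, so σ(S) is the expected number of nodes reachable from S along live edges
(`spread_eq_sum_reach`). Three bounds follow. (a) Changing every probability by at most η changes σ
by at most n³η (`spread_le_add_of_close`). (b) The losses from deleting single seeds add up to at
most σ(S), so some m-subset of S keeps at least the fraction m/|S| of σ(S) (`exists_subset_spread`).
(c) Let W be the nodes missed after one step of a random cascade with probability at most δ/(3n).
Raising the edges into W to 1 helps a target w only through a last node of W on its path. Which node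
that can be depends on edges into the complement of W only, hence is independent of whether the
seeds T₂ activate it in one step (`exists_loss_weights`). The expected loss is at most n · δ/(3n),
and Markov's inequality bounds the loss by εk/3. The weights in this bound depend neither on T₁ nor
on the learned network, so it does not matter that these depend on T₂.

For u ≠ v, P(u ∉ S₀, v ∉ S₁) (1 - q_u p_uv) = P(v ∉ S₁) (1 - q_u), and the edge estimate is the
empirical solution for p_uv. Multiplicative Chernoff bounds make it accurate to η = εk/(6n³) if v is
missed with probability at least δ/(6n) (`edgeEstimate_error`). The test at δ/(4n) puts all nodes
below δ/(6n) into V₂ and only nodes of W (`apEstimate_test_error`).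

Let p' be p with the edges into V₂ raised to 1. Passing from p to p' costs εk/3 by (c); passing
between p' and the learned network costs εk/6 by (a), twice; the smaller budget costs the fraction
2ε + ε/3 by (b) and rounding. As k ≤ σ(S*), the total is 3εσ(S*). The failure probabilities are at
most δ/3 for |T₂| > 2εk, δ/3 for (c), δ/6 for the test and δ/6 for the edge estimates. -/

namespace InfluenceMax

/-! ### Reachability and breadth first search -/

section Graph

variable {V : Type*}

/-- `w` is reachable from the node set `S` in the directed graph `G`. -/
def Reach (G : V → V → Prop) (S : Finset V) (w : V) : Prop :=
  ∃ a ∈ S, Relation.ReflTransGen G a w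

theorem Reach.of_mem {G : V → V → Prop} {S : Finset V} {w : V} (h : w ∈ S) : Reach G S w :=
  ⟨w, h, .refl⟩

/-- Loops never matter for reachability. The restriction to `u ≠ v` is needed later, since the edge
estimate is only controlled for distinct nodes. -/
theorem Reach.mono {G H : V → V → Prop} {S T : Finset V} {w : V}
    (hGH : ∀ u v, u ≠ v → G u v → H u v) (hST : S ⊆ T) : Reach G S w → Reach H T w := by
  rintro ⟨a, ha, h⟩
  refine ⟨a, hST ha, ?_⟩
  induction h with
  | refl => exact .refl
  | @tail b c _ hbc ih =>
    rcases eq_or_ne b c with rfl | hne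
    · exact ih
    · exact ih.tail (hGH b c hne hbc)

variable [Fintype V] [DecidableEq V]

open Classical in
/-- The out-neighbourhood of `N` in `G`. -/
def hit (G : V → V → Prop) (N : Finset V) : Finset V :=
  Finset.univ.filter fun v => ∃ u ∈ N, G u v

theorem mem_hit {G : V → V → Prop} {N : Finset V} {v : V} : v ∈ hit G N ↔ ∃ u ∈ N, G u v := by
  simp [hit]

/-- One round of breadth first search; a state consists of the visited nodes and the frontier. -/
def bfsStep (G : V → V → Prop) (s : Finset V × Finset V) : Finset V × Finset V :=
  (s.1 ∪ hit G s.2, (s.1 ∪ hit G s.2) \ s.1)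

/-- The last clause is the counting argument: each round with a nonempty frontier has found a new
node, so `n - 1` rounds exhaust either the frontier or all nodes. -/
theorem bfs_invariant (G : V → V → Prop) (S : Finset V) (j : ℕ) :
    let s := (bfsStep G)^[j] (S, S)
    S ⊆ s.1 ∧ (∀ w ∈ s.1, Reach G S w) ∧ s.2 ⊆ s.1 ∧
      (∀ u ∈ s.1, u ∉ s.2 → ∀ v, G u v → v ∈ s.1) ∧ (s.2 = ∅ ∨ j + 1 ≤ s.1.card) := by
  induction j with
  | zero =>
    refine ⟨subset_rfl, fun w hw => .of_mem hw, subset_rfl, fun u hu hu' => absurd hu hu', ?_⟩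
    rcases S.eq_empty_or_nonempty with h | h
    · exact .inl h
    · exact .inr (by simpa [Nat.succ_le_iff] using h.card_pos)
  | succ j ih =>
    simp only [Function.iterate_succ_apply']
    generalize (bfsStep G)^[j] (S, S) = s at ih
    obtain ⟨h1, h2, h3, h4, h5⟩ := ih
    simp only [bfsStep]
    refine ⟨h1.trans Finset.subset_union_left, ?_, Finset.sdiff_subset, ?_, ?_⟩
    · intro w hw
      rcases Finset.mem_union.1 hw with hw | hw
      · exact h2 w hw
      · obtain ⟨u, hu, huw⟩ := mem_hit.1 hw
        obtain ⟨a, ha, hau⟩ := h2 u (h3 hu)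
        exact ⟨a, ha, hau.tail huw⟩
    · intro u hu hu' v huv
      have hus : u ∈ s.1 := by
        by_contra h
        exact hu' (Finset.mem_sdiff.2 ⟨hu, h⟩)
      by_cases hus2 : u ∈ s.2
      · exact Finset.mem_union_right _ (mem_hit.2 ⟨u, hus2, huv⟩)
      · exact Finset.mem_union_left _ (h4 u hus hus2 v huv)
    · rcases Finset.eq_empty_or_nonempty ((s.1 ∪ hit G s.2) \ s.1) with h | h
      · exact .inl h
      · right
        have hlt : s.1.card < (s.1 ∪ hit G s.2).card := by
          have := Finset.card_sdiff_add_card_eq_card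
            (Finset.subset_union_left : s.1 ⊆ s.1 ∪ hit G s.2)
          have := h.card_pos
          omega
        rcases h5 with h5 | h5
        · obtain ⟨x, hx⟩ := h
          simp [h5, hit] at hx
        · omega

theorem mem_bfs_iff_reach (G : V → V → Prop) (S : Finset V) (w : V) :
    w ∈ ((bfsStep G)^[Fintype.card V - 1] (S, S)).1 ↔ Reach G S w := by
  have := bfs_invariant G S (Fintype.card V - 1)
  generalize (bfsStep G)^[Fintype.card V - 1] (S, S) = s at this
  obtain ⟨h1, h2, h3, h4, h5⟩ := this
  refine ⟨h2 w, ?_⟩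
  rintro ⟨a, ha, haw⟩
  rcases h5 with h5 | h5
  · induction haw with
    | refl => exact h1 ha
    | tail _ hbc ih => exact h4 _ ih (by simp [h5]) _ hbc
  · have : s.1 = Finset.univ := by
      rw [← Finset.card_eq_iff_eq_univ]
      have := s.1.card_le_univ
      omega
    simp [this]

theorem hit_congr {G H : V → V → Prop} {N : Finset V}
    (h : ∀ u ∈ N, ∀ v, G u v ↔ H u v) : hit G N = hit H N := by
  ext v
  simp only [mem_hit]
  exact exists_congr fun u => and_congr_right fun hu => h u hu v

/-- The search does not look at the edges out of visited nodes that are not on the frontier. -/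
theorem bfs_congr {G H : V → V → Prop} {A : Finset V}
    (h : ∀ u ∉ A, ∀ v, G u v ↔ H u v) (j : ℕ) (s : Finset V × Finset V)
    (hA : A ⊆ s.1) (hs : Disjoint s.2 A) : (bfsStep G)^[j] s = (bfsStep H)^[j] s := by
  induction j generalizing s with
  | zero => rfl
  | succ j ih =>
    have hst : bfsStep G s = bfsStep H s := by
      have : hit G s.2 = hit H s.2 :=
        hit_congr fun u hu => h u (Finset.disjoint_left.1 hs hu)
      simp [bfsStep, this]
    rw [Function.iterate_succ_apply, Function.iterate_succ_apply, hst]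
    refine ih _ (hA.trans Finset.subset_union_left) ?_
    rw [Finset.disjoint_left]
    intro u hu hu'
    exact (Finset.mem_sdiff.1 hu).2 (hA hu')

end Graph

/-! ### Live-edge representation of the diffusion -/

section LiveEdge

variable {V : Type*} [Fintype V] [DecidableEq V]

/-- The live edges: the edge `(u, v)` is live if the uniform variable `x (u, v)` is less than
`p u v`. -/
def live (p : Network V) (x : V × V → unitInterval) (u v : V) : Prop := x (u, v) < p u v

theorem measurableSet_threshold {ι : Type*} [Finite ι] (a : ι → unitInterval)
    (Φ : (ι → Prop) → Prop) : MeasurableSet {y : ι → unitInterval | Φ fun i => y i < a i} := by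
  have hm : Measurable fun (y : ι → unitInterval) (i : ι) => y i < a i := by
    refine measurable_pi_iff.2 fun i => ?_
    exact measurableSet_setOfPred.1 (measurableSet_lt (measurable_pi_apply i) measurable_const)
  exact hm (MeasurableSet.of_discrete (s := {y | Φ y}))

theorem measurableSet_live (p : Network V) (Φ : (V → V → Prop) → Prop) :
    MeasurableSet {x | Φ (live p x)} :=
  measurableSet_threshold (fun e : V × V => p e.1 e.2) fun g => Φ fun u v => g (u, v)

/-- Events that read disjoint sets of edges are independent, because the uniform variables are the
coordinates of a product measure. -/
theorem volume_live_and (p : Network V) (Φ Ψ : (V → V → Prop) → Prop) (E F : Finset (V × V))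
    (hEF : Disjoint E F)
    (hΦ : ∀ G H : V → V → Prop, (∀ u v, (u, v) ∈ E → (G u v ↔ H u v)) → (Φ G ↔ Φ H))
    (hΨ : ∀ G H : V → V → Prop, (∀ u v, (u, v) ∈ F → (G u v ↔ H u v)) → (Ψ G ↔ Ψ H)) :
    volume {x | Φ (live p x) ∧ Ψ (live p x)} =
      volume {x | Φ (live p x)} * volume {x | Ψ (live p x)} := by
  have hind : iIndepFun (fun (e : V × V) (x : V × V → unitInterval) => x e) volume :=
    iIndepFun_pi (μ := fun _ : V × V => (volume : Measure unitInterval)) (X := fun _ => id)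
      fun _ => aemeasurable_id
  have h := hind.indepFun_finset E F hEF fun e => measurable_pi_apply e
  have key : ∀ (E : Finset (V × V)) (Φ : (V → V → Prop) → Prop),
      (∀ G H : V → V → Prop, (∀ u v, (u, v) ∈ E → (G u v ↔ H u v)) → (Φ G ↔ Φ H)) →
      ∃ s : Set (E → unitInterval), MeasurableSet s ∧
        {x | Φ (live p x)} = (fun (x : V × V → unitInterval) (e : E) => x e) ⁻¹' s := by
    intro E Φ hΦ
    -- Edges outside `E` are declared dead, which `Φ` cannot notice.
    refine ⟨{y | Φ fun u v => ∃ h : (u, v) ∈ E, y ⟨(u, v), h⟩ < p u v},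
      measurableSet_threshold (fun e : E => p e.1.1 e.1.2)
        fun g => Φ fun u v => ∃ h : (u, v) ∈ E, g ⟨(u, v), h⟩, ?_⟩
    ext x
    refine hΦ _ _ fun u v h => ?_
    simp [live, h]
  obtain ⟨s, hs, hs'⟩ := key E Φ hΦ
  obtain ⟨t, ht, ht'⟩ := key F Ψ hΨ
  rw [Set.ofPred_and, hs', ht']
  exact h.measure_inter_preimage_eq_mul _ _ hs ht

theorem volume_live_forall (p : Network V) (Φ : V → (V → V → Prop) → Prop) (W : Finset V)
    (hΦ : ∀ v, ∀ G H : V → V → Prop, (∀ u, G u v ↔ H u v) → (Φ v G ↔ Φ v H)) :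
    volume {x | ∀ v ∈ W, Φ v (live p x)} = ∏ v ∈ W, volume {x | Φ v (live p x)} := by
  induction W using Finset.induction_on with
  | empty => simp
  | insert a W ha ih =>
    rw [Finset.prod_insert ha, ← ih]
    simp only [Finset.forall_mem_insert]
    refine volume_live_and p (Φ a) (fun G => ∀ v ∈ W, Φ v G) (Finset.univ ×ˢ {a})
      (Finset.univ ×ˢ W) ?_ ?_ ?_
    · rw [Finset.disjoint_left]
      rintro ⟨u, v⟩ h1 h2
      simp only [Finset.mem_product, Finset.mem_univ, true_and, Finset.mem_singleton] at h1 h2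
      exact ha (h1 ▸ h2)
    · intro G H h
      exact hΦ a G H fun u => h u a (by simp)
    · intro G H h
      exact forall₂_congr fun v hv => hΦ v G H fun u => h u v (by simp [hv])

theorem volume_live_none (p : Network V) (N : Finset V) (v : V) :
    volume {x | ∀ u ∈ N, ¬ live p x u v} = ∏ u ∈ N, ENNReal.ofReal (1 - (p u v : ℝ)) := by
  have : {x : V × V → unitInterval | ∀ u ∈ N, ¬ live p x u v} =
      Set.univ.pi fun e : V × V => if e.1 ∈ N ∧ e.2 = v then Set.Ici (p e.1 e.2) else Set.univ := by
    ext x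
    simp only [live, not_lt, Set.mem_ofPred_eq, Set.mem_pi, Set.mem_univ, true_imp_iff, Prod.forall]
    constructor
    · intro h a b
      split_ifs with hab
      · obtain ⟨h1, h2⟩ := hab
        subst h2
        exact h a h1
      · trivial
    · intro h u hu
      simpa [hu] using h u v
  rw [this, volume_pi_pi, Fintype.prod_prod_type, ← Finset.prod_subset (Finset.subset_univ N)]
  · refine Finset.prod_congr rfl fun u hu => ?_
    rw [Finset.prod_eq_single v]
    · simp [hu, unitInterval.volume_Ici]
    · intro b _ hb
      simp [hb]
    · simp
  · intro u _ hu
    simp [hu]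

theorem coe_activationProb (p : Network V) (N : Finset V) (v : V) :
    (activationProb p N v : ℝ) = 1 - ∏ u ∈ N, (1 - (p u v : ℝ)) := by
  have : ((∏ u ∈ N, unitInterval.symm (p u v) : unitInterval) : ℝ) =
      ∏ u ∈ N, (1 - (p u v : ℝ)) := by
    induction N using Finset.induction_on with
    | empty => simp
    | insert a N ha ih => simp [Finset.prod_insert ha, ih]
  simp [activationProb, this]

theorem volume_hit_eq (p : Network V) (N B : Finset V) :
    volume {x | hit (live p x) N = B} = subsetWeight (activationProb p N) B := by
  have h1 : {x | hit (live p x) N = B} =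
      {x | ∀ v ∈ Finset.univ, (v ∈ B ↔ ∃ u ∈ N, live p x u v)} := by
    ext x
    simp only [Set.mem_ofPred_eq, Finset.ext_iff, mem_hit, Finset.mem_univ, true_imp_iff]
    exact forall_congr' fun v => Iff.comm
  rw [h1, volume_live_forall p (fun v G => (v ∈ B ↔ ∃ u ∈ N, G u v))]
  · have hnone : ∀ v, volume {x | ∀ u ∈ N, ¬ live p x u v} =
        ENNReal.ofReal (1 - (activationProb p N v : ℝ)) := by
      intro v
      rw [volume_live_none, coe_activationProb, sub_sub_cancel,
        ENNReal.ofReal_prod_of_nonneg fun u _ => sub_nonneg.2 (p u v).2.2]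
    rw [subsetWeight, ENNReal.ofReal_mul (Finset.prod_nonneg fun v _ => (activationProb p N v).2.1),
      ENNReal.ofReal_prod_of_nonneg fun v _ => (activationProb p N v).2.1,
      ENNReal.ofReal_prod_of_nonneg fun v _ => sub_nonneg.2 (activationProb p N v).2.2,
      ← Finset.prod_mul_prod_compl B]
    congr 1
    · refine Finset.prod_congr rfl fun v hv => ?_
      have : {x : V × V → unitInterval | v ∈ B ↔ ∃ u ∈ N, live p x u v} =
          {x | ∀ u ∈ N, ¬ live p x u v}ᶜ := by
        ext x
        simp [hv]
      rw [this, prob_compl_eq_one_sub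
        (measurableSet_live p fun G => ∀ u ∈ N, ¬ G u v), hnone,
        ← ENNReal.ofReal_one, ← ENNReal.ofReal_sub _ (sub_nonneg.2 (activationProb p N v).2.2)]
      simp
    · refine Finset.prod_congr rfl fun v hv => ?_
      rw [← hnone]
      congr 1
      ext x
      simp [Finset.mem_compl.1 hv]
  · intro v G H h
    simp only [h]

/-- The transition kernel of the diffusion on pairs (active nodes, newly active nodes). -/
def stateStep (p : Network V) (s : Finset V × Finset V) : PMF (Finset V × Finset V) :=
  (randomSubset (activationProb p s.2)).map fun B => (s.1 ∪ B, (s.1 ∪ B) \ s.1)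

/-- The law of the diffusion state after `m` steps. -/
def stateSteps (p : Network V) : ℕ → Finset V × Finset V → PMF (Finset V × Finset V)
  | 0, s => PMF.pure s
  | m + 1, s => (stateStep p s).bind (stateSteps p m)

theorem stateSteps_succ' (p : Network V) (m : ℕ) (s : Finset V × Finset V) :
    stateSteps p (m + 1) s = (stateSteps p m s).bind (stateStep p) := by
  induction m generalizing s with
  | zero => simp [stateSteps]
  | succ m ih =>
    rw [stateSteps]
    conv_rhs => rw [stateSteps]
    rw [PMF.bind_bind]
    exact congrArg _ (funext ih)

/-- A step uses the history only through the active and the newly active nodes, so this pair is a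
Markov chain. -/
theorem icSteps_map_state (p : Network V) (S : Finset V) (m : ℕ) :
    (icSteps p S m).map (fun c => (c m, newlyActive c m)) = stateSteps p m (S, S) := by
  induction m with
  | zero => simp [icSteps, stateSteps, PMF.pure_map, newlyActive]
  | succ m ih =>
    rw [stateSteps_succ', ← ih, icSteps, PMF.map_bind, PMF.bind_map]
    refine congrArg _ (funext fun c => ?_)
    simp only [icStep, stateStep, PMF.map_comp, Function.comp_def]
    refine congrArg (fun f => PMF.map f _) (funext fun B => ?_)
    simp [newlyActive]

/-- Deferred decisions: the next round reads only edges out of `N ⊆ A`, all later rounds only edges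
out of nodes outside `A`. One fixed live graph therefore yields the same law as fresh randomness in
every step. -/
theorem stateSteps_apply (p : Network V) (j : ℕ) (A N : Finset V) (hN : N ⊆ A)
    (s : Finset V × Finset V) :
    stateSteps p j (A, N) s = volume {x | (bfsStep (live p x))^[j] (A, N) = s} := by
  induction j generalizing A N with
  | zero =>
    by_cases h : s = (A, N)
    · simp [stateSteps, h]
    · simp [stateSteps, h, Ne.symm h]
  | succ j ih =>
    have h1 : {x | (bfsStep (live p x))^[j + 1] (A, N) = s} =
        ⋃ B : Finset V, {x | hit (live p x) N = B ∧
          (bfsStep (live p x))^[j] (A ∪ B, (A ∪ B) \ A) = s} := by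
      ext x
      simp [bfsStep]
    rw [h1, measure_iUnion, tsum_fintype]
    · rw [stateSteps, stateStep, PMF.bind_map, PMF.bind_apply, tsum_fintype]
      refine Finset.sum_congr rfl fun B _ => ?_
      rw [Function.comp_apply, ih _ _ Finset.sdiff_subset,
        volume_live_and p (fun G => hit G N = B)
          (fun G => (bfsStep G)^[j] (A ∪ B, (A ∪ B) \ A) = s)
          (N ×ˢ Finset.univ) (Aᶜ ×ˢ Finset.univ), volume_hit_eq]
      · rfl
      · rw [Finset.disjoint_left]
        rintro ⟨u, v⟩ h h'
        simp only [Finset.mem_product, Finset.mem_univ, and_true, Finset.mem_compl] at h h'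
        exact h' (hN h)
      · intro G H h
        rw [hit_congr fun u hu v => h u v (by simp [hu])]
      · intro G H h
        rw [bfs_congr (A := A) (fun u hu v => h u v (by simp [hu])) j _
          Finset.subset_union_left Finset.sdiff_disjoint]
    · intro B B' hB
      refine Set.disjoint_left.2 fun x hx hx' => hB ?_
      exact hx.1.symm.trans hx'.1
    · intro B
      exact measurableSet_live p fun G => hit G N = B ∧
        (bfsStep G)^[j] (A ∪ B, (A ∪ B) \ A) = s

theorem icCascade_final_apply (p : Network V) (S A : Finset V) :
    ((icCascade p S).map fun c => c (Fintype.card V - 1)) A =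
      volume {x | ((bfsStep (live p x))^[Fintype.card V - 1] (S, S)).1 = A} := by
  have h := congrArg (PMF.map Prod.fst) (icSteps_map_state p S (Fintype.card V - 1))
  rw [PMF.map_comp] at h
  have h2 : (icCascade p S).map (fun c => c (Fintype.card V - 1)) =
    (stateSteps p (Fintype.card V - 1) (S, S)).map Prod.fst := h
  rw [h2, PMF.map_apply, tsum_fintype, Fintype.sum_prod_type]
  simp only [stateSteps_apply p _ S S subset_rfl]
  rw [Finset.sum_eq_single A]
  · simp only [if_true]
    rw [← tsum_fintype (L := .unconditional _), ← measure_iUnion]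
    · congr 1
      ext x
      simp [Prod.ext_iff]
    · intro B B' hB
      refine Set.disjoint_left.2 fun x hx hx' => hB ?_
      exact congrArg Prod.snd (hx.symm.trans hx')
    · intro B
      exact measurableSet_live p fun G => (bfsStep G)^[Fintype.card V - 1] (S, S) = (A, B)
  · intro B _ hB
    simp [hB.symm]
  · simp

/-- The live-edge representation of the influence spread. -/
theorem spread_eq_sum_reach (p : Network V) (S : Finset V) :
    spread p S = ∑ w, volume.real {x | Reach (live p x) S w} := by
  have h : ∀ w, volume.real {x | Reach (live p x) S w} =
      ∑ A : Finset V, if w ∈ A then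
        volume.real {x | ((bfsStep (live p x))^[Fintype.card V - 1] (S, S)).1 = A} else 0 := by
    intro w
    rw [← Finset.sum_filter]
    rw [← measureReal_biUnion_finset]
    · congr 1
      ext x
      simp [← mem_bfs_iff_reach]
    · intro B _ B' _ hB
      refine Set.disjoint_left.2 fun x hx hx' => hB ?_
      exact hx.symm.trans hx'
    · intro B _
      exact measurableSet_live p fun G => ((bfsStep G)^[Fintype.card V - 1] (S, S)).1 = B
  simp only [h, spread]
  rw [Finset.sum_comm]
  refine Finset.sum_congr rfl fun A _ => ?_
  rw [icCascade_final_apply, Finset.sum_ite_mem, Finset.univ_inter, Finset.sum_const, nsmul_eq_mul,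
    mul_comm]
  rfl

end LiveEdge

/-! ### Lipschitz bound, smaller budgets, and the loss from raised edges -/

section Spread

variable {V : Type*} [Fintype V] [DecidableEq V]

theorem spread_nonneg (p : Network V) (S : Finset V) : 0 ≤ spread p S := by
  rw [spread_eq_sum_reach]
  positivity

theorem card_le_spread (p : Network V) (S : Finset V) : (S.card : ℝ) ≤ spread p S := by
  rw [spread_eq_sum_reach]
  calc (S.card : ℝ) = ∑ w ∈ S, volume.real {x | Reach (live p x) S w} := by
        rw [Finset.cast_card]
        refine Finset.sum_congr rfl fun w hw => ?_
        simp [Reach.of_mem hw]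
    _ ≤ _ := Finset.sum_le_sum_of_subset_of_nonneg (Finset.subset_univ S)
        fun _ _ _ => measureReal_nonneg

theorem spread_mono {p p' : Network V} {S T : Finset V} (hp : ∀ u v, p u v ≤ p' u v)
    (hST : S ⊆ T) : spread p S ≤ spread p' T := by
  simp only [spread_eq_sum_reach]
  refine Finset.sum_le_sum fun w _ => measureReal_mono fun x hx => ?_
  exact Reach.mono (fun u v _ h => lt_of_lt_of_le h (hp u v)) hST hx

/-- Both networks are coupled through the same uniform variable, which must fall between the two
probabilities. -/
theorem volume_live_diff_le (p p' : Network V) (u v : V) :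
    volume.real {x | live p x u v ∧ ¬ live p' x u v} ≤ |(p u v : ℝ) - p' u v| := by
  have h : {x : V × V → unitInterval | live p x u v ∧ ¬ live p' x u v} =
      Function.eval (u, v) ⁻¹' Set.Ico (p' u v) (p u v) := by
    ext x
    simp [live, and_comm]
  rw [h, measureReal_def, volume_pi, (measurePreserving_eval (fun _ : V × V => (volume : Measure unitInterval))
    (u, v)).measure_preimage
    measurableSet_Ico.nullMeasurableSet, unitInterval.volume_Ico]
  rw [ENNReal.toReal_ofReal']
  exact max_le (le_abs_self _) (abs_nonneg _)

/-- The influence spread is Lipschitz in the edge probabilities. -/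
theorem spread_le_add_of_close {p p' : Network V} {η : ℝ} (hη : 0 ≤ η)
    (h : ∀ u v, u ≠ v → |(p u v : ℝ) - p' u v| ≤ η) (S : Finset V) :
    spread p S ≤ spread p' S + (Fintype.card V : ℝ) ^ 3 * η := by
  have key : ∀ w, volume.real {x | Reach (live p x) S w} ≤
      volume.real {x | Reach (live p' x) S w} + (Fintype.card V : ℝ) ^ 2 * η := by
    intro w
    have hsub : {x | Reach (live p x) S w} ⊆ {x | Reach (live p' x) S w} ∪
        ⋃ e ∈ (Finset.univ : Finset (V × V)).filter (fun e => e.1 ≠ e.2),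
          {x | live p x e.1 e.2 ∧ ¬ live p' x e.1 e.2} := by
      intro x hx
      by_contra hcon
      simp only [Set.mem_union, Set.mem_ofPred_eq, Set.mem_iUnion, not_or, not_exists,
        Finset.mem_filter, Finset.mem_univ, true_and, not_and, not_not] at hcon
      exact hcon.1 (Reach.mono (fun u v huv hl => hcon.2 (u, v) huv hl) subset_rfl hx)
    refine (measureReal_mono hsub).trans ((measureReal_union_le _ _).trans ?_)
    gcongr
    refine (measureReal_biUnion_finset_le _ _).trans ?_
    calc _ ≤ ∑ e ∈ (Finset.univ : Finset (V × V)).filter (fun e => e.1 ≠ e.2), η :=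
          Finset.sum_le_sum fun e he => (volume_live_diff_le p p' e.1 e.2).trans
            (h _ _ (Finset.mem_filter.1 he).2)
      _ ≤ ∑ e : V × V, η :=
          Finset.sum_le_sum_of_subset_of_nonneg (Finset.filter_subset _ _) fun _ _ _ => hη
      _ = _ := by simp [sq]
  simp only [spread_eq_sum_reach]
  calc _ ≤ ∑ w : V, (volume.real {x | Reach (live p' x) S w} + (Fintype.card V : ℝ) ^ 2 * η) :=
        Finset.sum_le_sum fun w _ => key w
    _ = _ := by
      rw [Finset.sum_add_distrib, Finset.sum_const, nsmul_eq_mul, Finset.card_univ]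
      ring

/-- For a fixed target, the events that it is reachable from `S` but not without `u` are disjoint
over `u`: on such an event `u` is the only seed that reaches it. -/
theorem sum_spread_sub_erase_le (p : Network V) (S : Finset V) :
    ∑ u ∈ S, (spread p S - spread p (S.erase u)) ≤ spread p S := by
  simp only [spread_eq_sum_reach, ← Finset.sum_sub_distrib]
  rw [Finset.sum_comm]
  refine Finset.sum_le_sum fun w _ => ?_
  have h : ∀ u, volume.real {x | Reach (live p x) S w} -
      volume.real {x | Reach (live p x) (S.erase u) w} =
      volume.real {x | Reach (live p x) S w ∧ ¬ Reach (live p x) (S.erase u) w} := by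
    intro u
    rw [← measureReal_sdiff]
    · rfl
    · intro x hx
      exact Reach.mono (fun _ _ _ => id) (Finset.erase_subset _ _) hx
    · exact measurableSet_live p fun G => Reach G (S.erase u) w
  simp only [h]
  rw [← measureReal_biUnion_finset]
  · refine measureReal_mono fun x hx => ?_
    simp only [Set.mem_iUnion] at hx
    obtain ⟨u, _, hu⟩ := hx
    exact hu.1
  · intro u _ u' _ huu'
    refine Set.disjoint_left.2 fun x hx hx' => ?_
    obtain ⟨⟨a, ha, haw⟩, hx⟩ := hx
    have h1 : a = u := by
      by_contra hne
      exact hx ⟨a, Finset.mem_erase.2 ⟨hne, ha⟩, haw⟩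
    have h2 : a = u' := by
      by_contra hne
      exact hx'.2 ⟨a, Finset.mem_erase.2 ⟨hne, ha⟩, haw⟩
    exact huu' (h1.symm.trans h2)
  · intro u _
    exact measurableSet_live p fun G => Reach G S w ∧ ¬ Reach G (S.erase u) w

theorem exists_erase_spread (p : Network V) {S : Finset V} (hS : S.Nonempty) :
    ∃ u ∈ S, ((S.card : ℝ) - 1) * spread p S ≤ S.card * spread p (S.erase u) := by
  by_contra! hcon
  have h := Finset.sum_lt_sum_of_nonempty hS hcon
  have h2 := sum_spread_sub_erase_le p S
  rw [Finset.sum_sub_distrib, Finset.sum_const, nsmul_eq_mul] at h2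
  rw [← Finset.mul_sum, Finset.sum_const, nsmul_eq_mul] at h
  have h3 : (0 : ℝ) < S.card := by exact_mod_cast hS.card_pos
  nlinarith

/-- Some subset of size `m` of a seed set keeps the proportional part of its spread. -/
theorem exists_subset_spread (p : Network V) (m : ℕ) (S : Finset V) (hm : m ≤ S.card) :
    ∃ S' ⊆ S, S'.card = m ∧ (m : ℝ) * spread p S ≤ S.card * spread p S' := by
  induction hd : S.card - m generalizing S with
  | zero => exact ⟨S, subset_rfl, by omega, by rw [show m = S.card by omega]⟩
  | succ d ih =>
    have hpos : 0 < S.card := by omega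
    obtain ⟨u, hu, hu'⟩ := exists_erase_spread p (Finset.card_pos.1 hpos)
    have hcard := Finset.card_erase_of_mem hu
    obtain ⟨S', hS', hc, hle⟩ := ih (S.erase u) (by omega) (by omega)
    refine ⟨S', hS'.trans (Finset.erase_subset _ _), hc, ?_⟩
    have hcR : ((S.erase u).card : ℝ) = S.card - 1 := by
      rw [hcard, Nat.cast_sub hpos, Nat.cast_one]
    rw [hcR] at hle
    -- For `m = 0` the factor `S.card - 1` may vanish and cannot be cancelled.
    rcases Nat.eq_zero_or_pos m with rfl | hm0
    · simp only [Nat.cast_zero, zero_mul]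
      exact mul_nonneg (Nat.cast_nonneg _) (spread_nonneg _ _)
    · have h1 : (0 : ℝ) < (S.card : ℝ) - 1 := by
        have : (1 : ℝ) < S.card := by exact_mod_cast (by omega : 1 < S.card)
        linarith
      refine le_of_mul_le_mul_left ?_ h1
      have hm' : (0 : ℝ) ≤ m := Nat.cast_nonneg m
      have hS0 : (0 : ℝ) ≤ S.card := Nat.cast_nonneg _
      calc ((S.card : ℝ) - 1) * (m * spread p S) = m * (((S.card : ℝ) - 1) * spread p S) := by ring
        _ ≤ m * (S.card * spread p (S.erase u)) := by gcongr
        _ = S.card * (m * spread p (S.erase u)) := by ring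
        _ ≤ S.card * (((S.card : ℝ) - 1) * spread p S') := by gcongr
        _ = _ := by ring

/-- The probability that `v` is inactive after the first step of a diffusion with seed set `S`. -/
def missProb (p : Network V) (S : Finset V) (v : V) : ℝ :=
  if v ∈ S then 0 else ∏ u ∈ S, (1 - (p u v : ℝ))

theorem missProb_nonneg (p : Network V) (S : Finset V) (v : V) : 0 ≤ missProb p S v := by
  unfold missProb
  split_ifs
  · exact le_rfl
  · exact Finset.prod_nonneg fun u _ => sub_nonneg.2 (p u v).2.2

/-- The edges of `G` into nodes outside `W`. -/
def restrictInto (G : V → V → Prop) (W : Finset V) (u v : V) : Prop := G u v ∧ v ∉ W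

/-- `v` is the selected node of `W` among those from which `w` is reachable by edges into nodes
outside `W`. -/
def IsSource (G : V → V → Prop) (W : Finset V) (w v : V) : Prop :=
  ∃ h : ∃ a ∈ W, Relation.ReflTransGen (restrictInto G W) a w, h.choose = v

/-- Cut the path at its last entry into `W`: the rest uses only edges of `G`. If `T'` contains the
selected source or has an edge to it, then `T'` reaches `w` in `G`. -/
theorem reach_or_isSource {G G' : V → V → Prop} {W T T' : Finset V} {w : V}
    (hG : ∀ u v, v ∉ W → G' u v → G u v) (h : Reach G' T w) :
    Reach G (T ∪ T') w ∨ ∃ v ∈ W, IsSource G W w v ∧ v ∉ T' ∧ ∀ u ∈ T', ¬ G u v := by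
  have h1 : Reach (restrictInto G W) T w ∨
      ∃ a ∈ W, Relation.ReflTransGen (restrictInto G W) a w := by
    obtain ⟨a, ha, haw⟩ := h
    induction haw with
    | refl => exact .inl (.of_mem ha)
    | @tail b c _ hbc ih =>
      by_cases hc : c ∈ W
      · exact .inr ⟨c, hc, .refl⟩
      · rcases ih with ⟨a', ha', h'⟩ | ⟨a', ha', h'⟩
        · exact .inl ⟨a', ha', h'.tail ⟨hG _ _ hc hbc, hc⟩⟩
        · exact .inr ⟨a', ha', h'.tail ⟨hG _ _ hc hbc, hc⟩⟩
  rcases h1 with h1 | h1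
  · exact .inl (Reach.mono (fun _ _ _ h => h.1) Finset.subset_union_left h1)
  · have hv := h1.choose_spec
    have hpath : Relation.ReflTransGen G h1.choose w :=
      Relation.ReflTransGen.mono (fun _ _ h => h.1) _ _ hv.2
    by_cases hv' : h1.choose ∈ T'
    · exact .inl ⟨_, Finset.mem_union_right _ hv', hpath⟩
    · by_cases hu : ∃ u ∈ T', G u h1.choose
      · obtain ⟨u, hu, huv⟩ := hu
        exact .inl ⟨u, Finset.mem_union_right _ hu, hpath.head huv⟩
      · exact .inr ⟨h1.choose, hv.1, ⟨h1, rfl⟩, hv', by simpa using hu⟩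

/-- The selection of the source reads edges into the complement of `W`, the activation of `v ∈ W`
reads edges into `v`; these are disjoint. -/
theorem volume_isSource_and (p : Network V) (W T : Finset V) (w v : V) (hv : v ∈ W) :
    volume.real {x | IsSource (live p x) W w v ∧ v ∉ T ∧ ∀ u ∈ T, ¬ live p x u v} =
      volume.real {x | IsSource (live p x) W w v} * missProb p T v := by
  unfold missProb
  split_ifs with hvT
  · simp [hvT]
  · simp only [hvT, not_false_eq_true, true_and]
    rw [measureReal_def, volume_live_and p (fun G => IsSource G W w v)
      (fun G => ∀ u ∈ T, ¬ G u v) (Finset.univ ×ˢ Wᶜ) (Finset.univ ×ˢ {v}), ENNReal.toReal_mul,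
      volume_live_none, ENNReal.toReal_prod, measureReal_def]
    · congr 1
      exact Finset.prod_congr rfl fun u _ => ENNReal.toReal_ofReal (sub_nonneg.2 (p u v).2.2)
    · rw [Finset.disjoint_left]
      rintro ⟨a, b⟩ h h'
      simp only [Finset.mem_product, Finset.mem_univ, true_and, Finset.mem_compl,
        Finset.mem_singleton] at h h'
      exact h (h' ▸ hv)
    · intro G H h
      have : restrictInto G W = restrictInto H W := by
        funext a b
        exact propext (and_congr_left fun hb => h a b (by simpa using hb))
      simp only [IsSource, this]
    · intro G H h
      exact forall₂_congr fun u _ => not_congr (h u v (by simp))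

/-- Changing the probabilities of the edges into `W` increases the spread, up to the influence of
those nodes of `W` which an extra seed set `T'` does not activate in one step. The weights `α` do
not depend on the seed sets or on the changed network. -/
theorem exists_loss_weights (p : Network V) (W : Finset V) :
    ∃ α : V → V → ℝ, (∀ w v, 0 ≤ α w v) ∧ (∀ w, ∑ v ∈ W, α w v ≤ 1) ∧
      ∀ (p' : Network V) (T T' : Finset V), (∀ u v, v ∉ W → p' u v = p u v) →
        spread p' T ≤ spread p (T ∪ T') + ∑ w, ∑ v ∈ W, α w v * missProb p T' v := by
  refine ⟨fun w v => volume.real {x | IsSource (live p x) W w v}, fun _ _ => measureReal_nonneg,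
    ?_, ?_⟩
  · intro w
    rw [← measureReal_biUnion_finset]
    · exact measureReal_le_one
    · intro v _ v' _ hvv'
      refine Set.disjoint_left.2 fun x hx hx' => hvv' ?_
      obtain ⟨h, rfl⟩ := hx
      obtain ⟨h', rfl⟩ := hx'
      rfl
    · intro v _
      exact measurableSet_live p fun G => IsSource G W w v
  · intro p' T T' hp'
    simp only [spread_eq_sum_reach, ← Finset.sum_add_distrib]
    refine Finset.sum_le_sum fun w _ => ?_
    have hsub : {x | Reach (live p' x) T w} ⊆ {x | Reach (live p x) (T ∪ T') w} ∪
        ⋃ v ∈ W, {x | IsSource (live p x) W w v ∧ v ∉ T' ∧ ∀ u ∈ T', ¬ live p x u v} := by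
      intro x hx
      rcases reach_or_isSource (G := live p x) (T' := T')
        (fun u v hv h => by unfold live at *; rwa [← hp' u v hv]) hx with h | ⟨v, hv, h⟩
      · exact .inl h
      · exact .inr (Set.mem_biUnion hv h)
    refine (measureReal_mono hsub).trans ((measureReal_union_le _ _).trans ?_)
    gcongr
    refine (measureReal_biUnion_finset_le _ _).trans ?_
    exact Finset.sum_le_sum fun v hv => (volume_isSource_and p W T' w v hv).le

end Spread

/-! ### Law of the seed set and of the first step -/

section FirstStep

variable {V : Type*} [Fintype V] [DecidableEq V]

theorem toReal_subsetWeight (a : V → unitInterval) (S : Finset V) :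
    (subsetWeight a S).toReal = (∏ v ∈ S, (a v : ℝ)) * ∏ v ∈ Sᶜ, (1 - (a v : ℝ)) :=
  ENNReal.toReal_ofReal (mul_nonneg (Finset.prod_nonneg fun v _ => (a v).2.1)
    (Finset.prod_nonneg fun v _ => sub_nonneg.2 (a v).2.2))

/-- The generating function of the random set. Zero-one values of `x` give avoidance probabilities,
constant values the exponential moments of the size. -/
theorem sum_subsetWeight_mul_prod (a : V → unitInterval) (x : V → ℝ) :
    ∑ S, (subsetWeight a S).toReal * ∏ v ∈ S, x v = ∏ v, ((a v : ℝ) * x v + (1 - a v)) := by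
  have h := Finset.prod_add (fun v => (a v : ℝ) * x v) (fun v => 1 - (a v : ℝ)) Finset.univ
  rw [h, Finset.powerset_univ]
  refine Finset.sum_congr rfl fun S _ => ?_
  rw [toReal_subsetWeight, Finset.prod_mul_distrib, ← Finset.compl_eq_univ_sdiff]
  ring

theorem prod_ite_eq_zero_one (u : V) (B : Finset V) :
    (∏ w ∈ B, if w = u then (0 : ℝ) else 1) = if u ∉ B then 1 else 0 := by
  by_cases hB : u ∈ B
  · simp [hB, Finset.prod_eq_zero hB]
  · simp only [hB, not_false_eq_true, if_true]
    exact Finset.prod_eq_one fun w hw => if_neg (ne_of_mem_of_not_mem hw hB)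

theorem icSteps_map_first (p : Network V) (S : Finset V) (m : ℕ) :
    (icSteps p S (m + 1)).map (fun c => (c 0, c 1)) =
      (randomSubset (activationProb p S)).map fun B => (S, S ∪ B) := by
  induction m with
  | zero =>
    simp [icSteps, icStep, PMF.map_comp, Function.comp_def, newlyActive]
  | succ m ih =>
    rw [icSteps, PMF.map_bind, ← ih]
    simp only [PMF.map_comp, Function.comp_def]
    simp [PMF.map, Function.comp_def]

/-- With a single node the cascade already ends at step 0; hence `hn`. -/
theorem cascadeLaw_map_first (p : Network V) (q : V → unitInterval) (hn : 2 ≤ Fintype.card V) :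
    (cascadeLaw p q).map (fun c => (c 0, c 1)) =
      (randomSubset q).bind fun S =>
        (randomSubset (activationProb p S)).map fun B => (S, S ∪ B) := by
  rw [cascadeLaw, PMF.map_bind]
  refine congrArg _ (funext fun S => ?_)
  obtain ⟨m, hm⟩ : ∃ m, Fintype.card V - 1 = m + 1 := ⟨Fintype.card V - 2, by omega⟩
  rw [icCascade, hm, icSteps_map_first]

theorem measurableSet_first (Φ : Finset V → Finset V → Prop) :
    MeasurableSet {c : Cascade V | Φ (c 0) (c 1)} := by
  have hm : Measurable fun c : Cascade V => (c 0, c 1) := by fun_prop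
  exact hm (MeasurableSet.of_discrete (s := {y : Finset V × Finset V | Φ y.1 y.2}))

open Classical in
theorem cascadeLaw_first_apply (p : Network V) (q : V → unitInterval) (hn : 2 ≤ Fintype.card V)
    (Φ : Finset V → Finset V → Prop) :
    (cascadeLaw p q).toMeasure.real {c | Φ (c 0) (c 1)} =
      ∑ S, (subsetWeight q S).toReal *
        ∑ B, (subsetWeight (activationProb p S) B).toReal * if Φ S (S ∪ B) then 1 else 0 := by
  have hm : Measurable fun c : Cascade V => (c 0, c 1) := by fun_prop
  have h := PMF.toMeasure_map_apply (fun c : Cascade V => (c 0, c 1)) (cascadeLaw p q)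
    {y | Φ y.1 y.2} hm .of_discrete
  have h' : (fun c : Cascade V => (c 0, c 1)) ⁻¹' {y | Φ y.1 y.2} = {c | Φ (c 0) (c 1)} := rfl
  rw [measureReal_def, ← h', ← h, cascadeLaw_map_first p q hn,
    PMF.toMeasure_bind_apply _ _ _ .of_discrete, tsum_fintype, ENNReal.toReal_sum]
  · refine Finset.sum_congr rfl fun S _ => ?_
    rw [ENNReal.toReal_mul, PMF.toMeasure_map_apply _ _ _ (measurable_of_finite _) .of_discrete,
      PMF.toMeasure_apply_fintype, ENNReal.toReal_sum]
    · congr 1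
      refine Finset.sum_congr rfl fun B _ => ?_
      by_cases hB : Φ S (S ∪ B)
      · simp [hB, randomSubset]
      · simp [hB]
    · intro B _
      refine ne_top_of_le_ne_top (PMF.apply_ne_top (randomSubset (activationProb p S)) B) ?_
      exact Set.indicator_le_self _ _ _
  · intro S _
    exact ENNReal.mul_ne_top (PMF.apply_ne_top _ _) (measure_ne_top _ _)

open Classical in
theorem cascadeLaw_seed_apply (p : Network V) (q : V → unitInterval) (hn : 2 ≤ Fintype.card V)
    (Φ : Finset V → Prop) :
    (cascadeLaw p q).toMeasure.real {c | Φ (c 0)} =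
      ∑ S, (subsetWeight q S).toReal * if Φ S then 1 else 0 := by
  rw [cascadeLaw_first_apply p q hn fun S _ => Φ S]
  refine Finset.sum_congr rfl fun S _ => ?_
  rw [← Finset.sum_mul]
  have := sum_subsetWeight_mul_prod (activationProb p S) fun _ => 1
  simp only [Finset.prod_const_one, mul_one, add_sub_cancel] at this
  rw [this, one_mul]

open Classical in
theorem cascadeLaw_seed_miss_apply (p : Network V) (q : V → unitInterval)
    (hn : 2 ≤ Fintype.card V) (Φ : Finset V → Prop) (v : V) :
    (cascadeLaw p q).toMeasure.real {c | Φ (c 0) ∧ v ∉ c 1} =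
      ∑ S, (subsetWeight q S).toReal * if Φ S then missProb p S v else 0 := by
  rw [cascadeLaw_first_apply p q hn fun S A => Φ S ∧ v ∉ A]
  refine Finset.sum_congr rfl fun S _ => ?_
  congr 1
  by_cases hΦ : Φ S
  · by_cases hv : v ∈ S
    · simp [hv, missProb]
    · simp only [hΦ, true_and, if_true, Finset.mem_union, hv, false_or, missProb, if_false]
      have := sum_subsetWeight_mul_prod (activationProb p S) fun u => if u = v then 0 else 1
      simp only [prod_ite_eq_zero_one] at this
      rw [this, Finset.prod_eq_single v]
      · simp [coe_activationProb]
      · intro u _ hu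
        simp [hu]
      · simp
  · simp [hΦ]

/-- The probability that `v` is inactive after the first step of a random cascade. -/
def missAvg (p : Network V) (q : V → unitInterval) (v : V) : ℝ :=
  ∑ S, (subsetWeight q S).toReal * missProb p S v

theorem missProb_eq_prod (p : Network V) (S : Finset V) (v : V) :
    missProb p S v = ∏ u ∈ S, if u = v then 0 else 1 - (p u v : ℝ) := by
  unfold missProb
  split_ifs with h
  · rw [Finset.prod_eq_zero h (by simp)]
  · exact Finset.prod_congr rfl fun u hu => by rw [if_neg (ne_of_mem_of_not_mem hu h)]

theorem cascadeLaw_miss (p : Network V) (q : V → unitInterval) (hn : 2 ≤ Fintype.card V) (v : V) :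
    (cascadeLaw p q).toMeasure.real {c | v ∉ c 1} = missAvg p q v := by
  have := cascadeLaw_seed_miss_apply p q hn (fun _ => True) v
  simpa [missAvg] using this

theorem cascadeLaw_notMem (p : Network V) (q : V → unitInterval) (hn : 2 ≤ Fintype.card V) (u : V) :
    (cascadeLaw p q).toMeasure.real {c | u ∉ c 0} = 1 - q u := by
  rw [cascadeLaw_seed_apply p q hn fun S => u ∉ S]
  have := sum_subsetWeight_mul_prod q fun w => if w = u then 0 else 1
  simp only [prod_ite_eq_zero_one] at this
  convert this using 1
  · refine Finset.sum_congr rfl fun S _ => ?_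
    congr
  rw [Finset.prod_eq_single u]
  · simp
  · intro w _ hw
    simp [hw]
  · simp

/-- The edge probability in terms of one-step activation probabilities. -/
theorem cascadeLaw_notMem_miss_mul (p : Network V) (q : V → unitInterval)
    (hn : 2 ≤ Fintype.card V) {u v : V} (huv : u ≠ v) :
    (cascadeLaw p q).toMeasure.real {c | u ∉ c 0 ∧ v ∉ c 1} * (1 - q u * p u v) =
      missAvg p q v * (1 - q u) := by
  rw [cascadeLaw_seed_miss_apply p q hn fun S => u ∉ S]
  have h1 : ∀ S : Finset V, (if u ∉ S then missProb p S v else 0) =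
      ∏ w ∈ S, if w = u then 0 else if w = v then 0 else 1 - (p w v : ℝ) := by
    intro S
    by_cases hu : u ∈ S
    · simp [hu, Finset.prod_eq_zero hu]
    · simp only [hu, not_false_eq_true, if_true, missProb_eq_prod]
      exact Finset.prod_congr rfl fun w hw => by rw [if_neg (ne_of_mem_of_not_mem hw hu)]
  have h2 := sum_subsetWeight_mul_prod q
    fun w => if w = u then 0 else if w = v then 0 else 1 - (p w v : ℝ)
  have h3 := sum_subsetWeight_mul_prod q fun w => if w = v then 0 else 1 - (p w v : ℝ)
  simp only [missAvg, missProb_eq_prod p _ v]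
  simp only [missProb_eq_prod p _ v] at h1
  rw [h3]
  have h4 : (∑ S, (subsetWeight q S).toReal * if u ∉ S then
      (∏ w ∈ S, if w = v then 0 else 1 - (p w v : ℝ)) else 0) =
      ∏ w, ((q w : ℝ) * (if w = u then 0 else if w = v then 0 else 1 - (p w v : ℝ)) +
        (1 - q w)) := by
    rw [← h2]
    exact Finset.sum_congr rfl fun S _ => by rw [← h1]
  have h5 : ∀ f : V → ℝ, ∏ w, f w = f u * ∏ w ∈ Finset.univ.erase u, f w :=
    fun f => (Finset.mul_prod_erase _ f (Finset.mem_univ u)).symm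
  have h6 : (∏ w ∈ Finset.univ.erase u,
      ((q w : ℝ) * (if w = u then 0 else if w = v then 0 else 1 - (p w v : ℝ)) + (1 - q w))) =
      ∏ w ∈ Finset.univ.erase u,
      ((q w : ℝ) * (if w = v then 0 else 1 - (p w v : ℝ)) + (1 - q w)) :=
    Finset.prod_congr rfl fun w hw => by rw [if_neg (Finset.ne_of_mem_erase hw)]
  convert_to (∏ w, ((q w : ℝ) * (if w = u then 0 else if w = v then 0 else 1 - (p w v : ℝ)) +
        (1 - q w))) * _ = _
  · rw [← h4]
  -- Both probabilities are products over the nodes that differ only in the factor of `u`: `1 - q u`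
  -- against `1 - q u * p u v`.
  rw [h5, h6, h5 fun w => (q w : ℝ) * (if w = v then 0 else 1 - (p w v : ℝ)) + (1 - q w)]
  simp only [if_true, if_neg huv]
  ring

/-- A Chernoff bound for the size of a random seed set. -/
theorem cascadeLaw_card_seed_le (p : Network V) (q : V → unitInterval)
    (hn : 2 ≤ Fintype.card V) {K : ℝ} (hK : ∑ u, (q u : ℝ) ≤ K) (hK0 : 0 ≤ K) :
    (cascadeLaw p q).toMeasure.real {c | 2 * K < ((c 0).card : ℝ)} ≤ Real.exp (-(K / 3)) := by
  rw [cascadeLaw_seed_apply p q hn fun S => 2 * K < (S.card : ℝ)]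
  -- Exponential moment at `log 2`; the exponent `1 / 3` comes from `2 * log 2 - 1 > 1 / 3`.
  have h := sum_subsetWeight_mul_prod q fun _ => Real.exp (Real.log 2)
  calc _ ≤ ∑ S, (subsetWeight q S).toReal *
        (Real.exp (-(2 * K * Real.log 2)) * ∏ v ∈ S, Real.exp (Real.log 2)) := by
        refine Finset.sum_le_sum fun S _ => ?_
        refine mul_le_mul_of_nonneg_left ?_ ENNReal.toReal_nonneg
        split_ifs with hS
        · rw [Finset.prod_const, ← Real.exp_nat_mul, ← Real.exp_add]
          refine Real.one_le_exp ?_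
          have := Real.log_nonneg (by norm_num : (1 : ℝ) ≤ 2)
          nlinarith
        · positivity
    _ = Real.exp (-(2 * K * Real.log 2)) * ∏ v, ((q v : ℝ) * Real.exp (Real.log 2) + (1 - q v)) := by
        rw [← h, Finset.mul_sum]
        exact Finset.sum_congr rfl fun S _ => by ring
    _ ≤ Real.exp (-(2 * K * Real.log 2)) * ∏ v, Real.exp (q v : ℝ) := by
        gcongr with v
        · intro v _
          have := (q v).2.1
          have := (q v).2.2
          have := Real.exp_pos (Real.log 2)
          nlinarith
        · rw [Real.exp_log (by norm_num)]
          linarith [Real.add_one_le_exp (q v : ℝ)]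
    _ = Real.exp (-(2 * K * Real.log 2) + ∑ v, (q v : ℝ)) := by
        rw [← Real.exp_sum, Real.exp_add]
    _ ≤ _ := by
        refine Real.exp_le_exp.2 ?_
        have := Real.log_two_gt_d9
        nlinarith

/-- Markov's inequality for the loss caused by nodes which the seeds fail to activate. -/
theorem cascadeLaw_loss_le (p : Network V) (q : V → unitInterval) (hn : 2 ≤ Fintype.card V)
    (W : Finset V) (α : V → V → ℝ) (hα : ∀ w v, 0 ≤ α w v) (hα1 : ∀ w, ∑ v ∈ W, α w v ≤ 1)
    {β θ : ℝ} (hβ : 0 ≤ β) (hW : ∀ v ∈ W, missAvg p q v ≤ β) (hθ : 0 < θ) :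
    (cascadeLaw p q).toMeasure.real
      {c | θ ≤ ∑ w, ∑ v ∈ W, α w v * missProb p (c 0) v} ≤ Fintype.card V * β / θ := by
  rw [cascadeLaw_seed_apply p q hn fun S => θ ≤ ∑ w, ∑ v ∈ W, α w v * missProb p S v]
  calc _ ≤ ∑ S, (subsetWeight q S).toReal *
        ((∑ w, ∑ v ∈ W, α w v * missProb p S v) / θ) := by
        refine Finset.sum_le_sum fun S _ => ?_
        refine mul_le_mul_of_nonneg_left ?_ ENNReal.toReal_nonneg
        split_ifs with hS
        · rwa [le_div_iff₀ hθ, one_mul]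
        · exact div_nonneg (Finset.sum_nonneg fun w _ => Finset.sum_nonneg fun v _ =>
            mul_nonneg (hα w v) (missProb_nonneg p S v)) hθ.le
    _ = (∑ w, ∑ v ∈ W, α w v * missAvg p q v) / θ := by
        simp only [← mul_div_assoc, ← Finset.sum_div, missAvg, Finset.mul_sum]
        congr 1
        rw [Finset.sum_comm]
        refine Finset.sum_congr rfl fun w _ => ?_
        rw [Finset.sum_comm]
        exact Finset.sum_congr rfl fun v _ => Finset.sum_congr rfl fun S _ => by ring
    _ ≤ (∑ w : V, β) / θ := by
        gcongr with w
        calc _ ≤ ∑ v ∈ W, α w v * β :=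
              Finset.sum_le_sum fun v hv => mul_le_mul_of_nonneg_left (hW v hv) (hα w v)
          _ = (∑ v ∈ W, α w v) * β := by rw [Finset.sum_mul]
          _ ≤ 1 * β := mul_le_mul_of_nonneg_right (hα1 w) hβ
          _ = β := one_mul β
    _ = _ := by simp

end FirstStep

/-! ### Multiplicative Chernoff bounds -/

section Chernoff

variable {Ω X ι : Type*} [MeasurableSpace Ω] [MeasurableSpace X] {P : Measure Ω}
  [IsProbabilityMeasure P] {ν : Measure X} [IsProbabilityMeasure ν] {C : ι → Ω → X}

/-- The number of indices `i ∈ I` with `C i ω ∈ B`. -/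
def hitCount (C : ι → Ω → X) (I : Finset ι) (B : Set X) (ω : Ω) : ℝ :=
  ∑ i ∈ I, B.indicator (fun _ => (1 : ℝ)) (C i ω)

theorem aemeasurable_hitCount (hlaw : ∀ i, HasLaw (C i) ν P) (I : Finset ι) {B : Set X}
    (hB : MeasurableSet B) : AEMeasurable (hitCount C I B) P := by
  unfold hitCount
  exact Finset.aemeasurable_fun_sum _ fun i _ =>
    (measurable_const.indicator hB).comp_aemeasurable (hlaw i).aemeasurable

theorem integrable_exp_hitCount (hlaw : ∀ i, HasLaw (C i) ν P) (I : Finset ι) {B : Set X}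
    (hB : MeasurableSet B) (s : ℝ) :
    Integrable (fun ω => Real.exp (s * hitCount C I B ω)) P := by
  refine Integrable.of_bound (C := Real.exp (|s| * I.card))
    (((aemeasurable_hitCount hlaw I hB).const_mul s).exp.aestronglyMeasurable) (.of_forall fun ω => ?_)
  rw [Real.norm_eq_abs, Real.abs_exp]
  refine Real.exp_le_exp.2 ((le_abs_self _).trans ?_)
  rw [abs_mul]
  gcongr
  unfold hitCount
  refine (Finset.abs_sum_le_sum_abs _ _).trans ?_
  rw [Finset.cast_card]
  refine Finset.sum_le_sum fun i _ => ?_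
  by_cases h : C i ω ∈ B <;> simp [h]

/-- Each factor equals `1 + (exp s - 1) * ν.real B`, and `1 + y ≤ exp y`. -/
theorem mgf_hitCount_le (hC : iIndepFun C P) (hlaw : ∀ i, HasLaw (C i) ν P) (I : Finset ι)
    {B : Set X} (hB : MeasurableSet B) (s : ℝ) :
    mgf (hitCount C I B) P s ≤ Real.exp ((Real.exp s - 1) * (I.card * ν.real B)) := by
  have hf : Measurable (B.indicator fun _ => (1 : ℝ)) := measurable_const.indicator hB
  have hind : iIndepFun (fun i ω => B.indicator (fun _ => (1 : ℝ)) (C i ω)) P :=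
    hC.comp₀ (fun _ => B.indicator fun _ => (1 : ℝ)) (fun i => (hlaw i).aemeasurable)
      fun i => hf.aemeasurable
  have hsum : hitCount C I B = ∑ i ∈ I, fun ω => B.indicator (fun _ => (1 : ℝ)) (C i ω) := by
    ext ω
    simp [hitCount]
  rw [hsum, hind.mgf_sum₀ fun i => hf.comp_aemeasurable (hlaw i).aemeasurable]
  have hone : ∀ i, mgf (fun ω => B.indicator (fun _ => (1 : ℝ)) (C i ω)) P s ≤
      Real.exp ((Real.exp s - 1) * ν.real B) := by
    intro i
    have h1 : mgf (fun ω => B.indicator (fun _ => (1 : ℝ)) (C i ω)) P s =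
        ∫ x, Real.exp (s * B.indicator (fun _ => (1 : ℝ)) x) ∂ν := by
      rw [mgf, ← (hlaw i).map_eq, integral_map (hlaw i).aemeasurable]
      exact (hf.const_mul s).exp.aestronglyMeasurable
    have h2 : ∀ x, Real.exp (s * B.indicator (fun _ => (1 : ℝ)) x) =
        1 + B.indicator (fun _ => Real.exp s - 1) x := by
      intro x
      by_cases hx : x ∈ B <;> simp [hx]
    rw [h1]
    simp only [h2]
    rw [integral_add (integrable_const _) ((integrable_const _).indicator hB),
      integral_indicator_const _ hB]
    simp only [integral_const, probReal_univ, smul_eq_mul, mul_one]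
    linarith [Real.add_one_le_exp ((Real.exp s - 1) * ν.real B)]
  calc _ ≤ ∏ i ∈ I, Real.exp ((Real.exp s - 1) * ν.real B) :=
        Finset.prod_le_prod (fun i _ => mgf_nonneg) fun i _ => hone i
    _ = _ := by
        rw [Finset.prod_const, ← Real.exp_nat_mul]
        congr 1
        ring

/-- The multiplicative Chernoff bound for the upper tail. -/
theorem hitCount_upper (hC : iIndepFun C P) (hlaw : ∀ i, HasLaw (C i) ν P) (I : Finset ι)
    {B : Set X} (hB : MeasurableSet B) {K ρ : ℝ} (hρ : 0 ≤ ρ) (hρ' : ρ ≤ 1)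
    (hK : I.card * ν.real B ≤ K) :
    P.real {ω | (1 + ρ) * K ≤ hitCount C I B ω} ≤ Real.exp (-(ρ ^ 2 * K / 4)) := by
  have hK0 : 0 ≤ K := le_trans (by positivity) hK
  -- With `exp t - 1 ≤ t + t ^ 2`, the choice `t = ρ / 2` yields the exponent `-ρ ^ 2 * K / 4`.
  refine (measure_ge_le_exp_mul_mgf (t := ρ / 2) _ (by positivity)
    (integrable_exp_hitCount hlaw I hB _)).trans ?_
  refine (mul_le_mul_of_nonneg_left (mgf_hitCount_le hC hlaw I hB _) (Real.exp_pos _).le).trans ?_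
  rw [← Real.exp_add]
  refine Real.exp_le_exp.2 ?_
  have h1 : |ρ / 2| ≤ 1 := by rw [abs_of_nonneg (by positivity)]; linarith
  have h2 := (abs_le.1 (Real.abs_exp_sub_one_sub_id_le h1)).2
  have h3 : 0 ≤ Real.exp (ρ / 2) - 1 := by linarith [Real.add_one_le_exp (ρ / 2)]
  have h4 := mul_le_mul_of_nonneg_left hK h3
  nlinarith

/-- The multiplicative Chernoff bound for the lower tail. -/
theorem hitCount_lower (hC : iIndepFun C P) (hlaw : ∀ i, HasLaw (C i) ν P) (I : Finset ι)
    {B : Set X} (hB : MeasurableSet B) {K ρ : ℝ} (hρ : 0 ≤ ρ) (hρ' : ρ ≤ 1) (hK0 : 0 ≤ K)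
    (hK : K ≤ I.card * ν.real B) :
    P.real {ω | hitCount C I B ω ≤ (1 - ρ) * K} ≤ Real.exp (-(ρ ^ 2 * K / 4)) := by
  refine (measure_le_le_exp_mul_mgf (t := -(ρ / 2)) _ (by linarith)
    (integrable_exp_hitCount hlaw I hB _)).trans ?_
  refine (mul_le_mul_of_nonneg_left (mgf_hitCount_le hC hlaw I hB _) (Real.exp_pos _).le).trans ?_
  rw [← Real.exp_add]
  refine Real.exp_le_exp.2 ?_
  have h1 : |-(ρ / 2)| ≤ 1 := by rw [abs_neg, abs_of_nonneg (by positivity)]; linarith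
  have h2 := (abs_le.1 (Real.abs_exp_sub_one_sub_id_le h1)).2
  have h3 : 0 ≤ 1 - Real.exp (-(ρ / 2)) := by
    have := Real.exp_le_one_iff.2 (by linarith : -(ρ / 2) ≤ 0)
    linarith
  have h4 := mul_le_mul_of_nonneg_left hK h3
  nlinarith

/-- The relative frequency is close to the probability, with a small relative error. -/
theorem hitCount_rel (hC : iIndepFun C P) (hlaw : ∀ i, HasLaw (C i) ν P) (I : Finset ι)
    {B : Set X} (hB : MeasurableSet B) {ρ : ℝ} (hρ : 0 ≤ ρ) (hρ' : ρ ≤ 1) (hI : 0 < I.card) :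
    P.real {ω | ¬ |hitCount C I B ω / I.card - ν.real B| < ρ * ν.real B} ≤
      2 * Real.exp (-(ρ ^ 2 * (I.card * ν.real B) / 4)) := by
  have hI' : (0 : ℝ) < I.card := by exact_mod_cast hI
  have hsub : {ω | ¬ |hitCount C I B ω / I.card - ν.real B| < ρ * ν.real B} ⊆
      {ω | (1 + ρ) * (I.card * ν.real B) ≤ hitCount C I B ω} ∪
      {ω | hitCount C I B ω ≤ (1 - ρ) * (I.card * ν.real B)} := by
    intro ω hω
    by_contra hcon
    simp only [Set.mem_union, Set.mem_ofPred_eq, not_or, not_le] at hcon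
    refine hω (abs_lt.2 ⟨?_, ?_⟩)
    · rw [lt_sub_iff_add_lt, lt_div_iff₀ hI']
      linarith [hcon.2]
    · rw [sub_lt_iff_lt_add, div_lt_iff₀ hI']
      linarith [hcon.1]
  refine (measureReal_mono hsub).trans ((measureReal_union_le _ _).trans ?_)
  rw [two_mul]
  exact add_le_add (hitCount_upper hC hlaw I hB hρ hρ' le_rfl)
    (hitCount_lower hC hlaw I hB hρ hρ' (by positivity) le_rfl)

end Chernoff

/-! ### Accuracy of the edge estimates and of the activation test -/

section Estimation

variable {V : Type*} [Fintype V] [DecidableEq V] {Ω : Type*} [MeasurableSpace Ω]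

open Classical in
theorem hitCount_eq_card {X ι : Type*} (C : ι → Ω → X) (I : Finset ι) (B : Set X) (ω : Ω) :
    hitCount C I B ω = ((I.filter fun i => C i ω ∈ B).card : ℝ) := by
  simp [hitCount, Set.indicator_apply]

theorem apEstimate_eq {t : ℕ} (C : Fin t → Ω → Cascade V) (I : Finset (Fin t)) (hI : 0 < I.card)
    (v : V) (ω : Ω) :
    apEstimate (fun i => C i ω) I v = 1 - hitCount C I {c | v ∉ c 1} ω / I.card := by
  have hI' : (I.card : ℝ) ≠ 0 := by exact_mod_cast hI.ne'
  have h := Finset.card_filter_add_card_filter_not (s := I) fun i => v ∈ C i ω 1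
  have h' : ((I.filter fun i => v ∈ C i ω 1).card : ℝ) + (I.filter fun i => v ∉ C i ω 1).card =
    I.card := by exact_mod_cast h
  rw [apEstimate, hitCount_eq_card]
  simp only [Set.mem_ofPred_eq]
  rw [eq_sub_iff_add_eq, ← add_div, div_eq_one_iff_eq hI', ← h']

/-- The quotient `a' * x' / y'` has relative error at most `3.5 * ρ` and replacing `q'` by `q` costs
another `ρ`; dividing by `q' ≥ 0.9 * γ` turns `4.5 * ρ` into `5 * ρ / γ`. -/
theorem abs_edge_estimate_sub_le {a x y q a' x' y' q' p γ ρ : ℝ} (hγ : 0 < γ) (hγq : γ ≤ q)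
    (hq1 : q ≤ 1) (hp0 : 0 ≤ p) (hp1 : p ≤ 1) (ha : 0 < a) (hx : 0 < x) (hy : 0 < y)
    (hρ0 : 0 ≤ ρ) (hρ : ρ ≤ 1 / 10) (hrel : y * (1 - q * p) = a * x)
    (ha' : |a' - a| < ρ * a) (hx' : |x' - x| < ρ * x) (hy' : |y' - y| < ρ * y)
    (hq' : |q' - q| < ρ * q) :
    |(1 - a' * x' / y') / q' - p| ≤ 5 * ρ / γ := by
  obtain ⟨ha1, ha2⟩ := abs_lt.1 ha'
  obtain ⟨hx1, hx2⟩ := abs_lt.1 hx'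
  obtain ⟨hy1, hy2⟩ := abs_lt.1 hy'
  obtain ⟨hq1', hq2'⟩ := abs_lt.1 hq'
  have hq0 : 0 < q := hγ.trans_le hγq
  have hρmul : ∀ {z : ℝ}, 0 < z → ρ * z ≤ 1 / 10 * z := fun hz =>
    mul_le_mul_of_nonneg_right hρ hz.le
  have hy'0 : 0 < y' := by linarith [hρmul hy]
  have ha'0 : 0 < a' := by linarith [hρmul ha]
  have hx'0 : 0 < x' := by linarith [hρmul hx]
  have hq'0 : 0.9 * γ ≤ q' := by linarith [hρmul hq0]
  have hq'pos : 0 < q' := by linarith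
  have hr0 : 0 ≤ 1 - q * p := by linarith [mul_le_one₀ hq1 hp0 hp1]
  have hr1 : 1 - q * p ≤ 1 := by linarith [mul_nonneg hq0.le hp0]
  set r := 1 - q * p with hr
  have hax : 0 < a * x := mul_pos ha hx
  have hρr' : ρ * r ≤ 1 / 10 * r := mul_le_mul_of_nonneg_right hρ hr0
  have hup : a' * x' ≤ (1 + ρ) ^ 2 * (a * x) := by
    calc a' * x' ≤ ((1 + ρ) * a) * ((1 + ρ) * x) :=
          mul_le_mul (by linarith) (by linarith) hx'0.le (by positivity)
      _ = _ := by ring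
  have hlo : (1 - ρ) ^ 2 * (a * x) ≤ a' * x' := by
    calc _ = ((1 - ρ) * a) * ((1 - ρ) * x) := by ring
      _ ≤ a' * x' := mul_le_mul (by linarith) (by linarith)
          (mul_nonneg (by linarith) hx.le) ha'0.le
  have hyr : 0 ≤ y * r := mul_nonneg hy.le hr0
  have hr'up : a' * x' / y' ≤ r + 3.5 * ρ * r := by
    rw [div_le_iff₀ hy'0]
    have h1 : (1 + ρ) ^ 2 ≤ (1 + 3.5 * ρ) * (1 - ρ) := by nlinarith
    calc a' * x' ≤ (1 + ρ) ^ 2 * (y * r) := by rw [hrel]; exact hup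
      _ ≤ (1 + 3.5 * ρ) * (1 - ρ) * (y * r) := mul_le_mul_of_nonneg_right h1 hyr
      _ = (r + 3.5 * ρ * r) * ((1 - ρ) * y) := by ring
      _ ≤ (r + 3.5 * ρ * r) * y' := mul_le_mul_of_nonneg_left (by linarith) (by positivity)
  have hr'lo : r - 3.5 * ρ * r ≤ a' * x' / y' := by
    rw [le_div_iff₀ hy'0]
    have h1 : (1 - 3.5 * ρ) * (1 + ρ) ≤ (1 - ρ) ^ 2 := by nlinarith
    calc (r - 3.5 * ρ * r) * y' ≤ (r - 3.5 * ρ * r) * ((1 + ρ) * y) :=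
          mul_le_mul_of_nonneg_left (by linarith) (by linarith [hρr', mul_nonneg hρ0 hr0])
      _ = (1 - 3.5 * ρ) * (1 + ρ) * (y * r) := by ring
      _ ≤ (1 - ρ) ^ 2 * (y * r) := mul_le_mul_of_nonneg_right h1 hyr
      _ ≤ a' * x' := by rw [hrel]; exact hlo
  have hρr : ρ * r ≤ ρ := mul_le_of_le_one_right hρ0 hr1
  have hqp : |(q - q') * p| ≤ ρ := by
    rw [abs_mul, abs_of_nonneg hp0, abs_sub_comm]
    calc |q' - q| * p ≤ |q' - q| * 1 := mul_le_mul_of_nonneg_left hp1 (abs_nonneg _)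
      _ ≤ ρ := by linarith [mul_le_of_le_one_right hρ0 hq1]
  have hnum : |(r - a' * x' / y') + (q - q') * p| ≤ 4.5 * ρ := by
    refine (abs_add_le _ _).trans ?_
    have : |r - a' * x' / y'| ≤ 3.5 * ρ := abs_le.2 ⟨by linarith, by linarith⟩
    linarith
  have heq : (1 - a' * x' / y') / q' - p = ((r - a' * x' / y') + (q - q') * p) / q' := by
    rw [hr, eq_div_iff hq'pos.ne', sub_mul, div_mul_cancel₀ _ hq'pos.ne']
    ring
  rw [heq, abs_div, abs_of_pos hq'pos, div_le_div_iff₀ hq'pos hγ]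
  calc _ ≤ 4.5 * ρ * γ := mul_le_mul_of_nonneg_right hnum hγ.le
    _ = 5 * ρ * (0.9 * γ) := by ring
    _ ≤ 5 * ρ * q' := mul_le_mul_of_nonneg_left hq'0 (by positivity)

/-- Rewrites the estimate in the frequencies of `v ∉ S₁`, `u ∉ S₀`, `u ∈ S₀` and of the joint event
`u ∉ S₀, v ∉ S₁`, to which the Chernoff bounds apply. Positive counts exclude the conventions for
division by zero. -/
theorem edgeEstimate_eq {t : ℕ} (C : Fin t → Ω → Cascade V) (I : Finset (Fin t))
    (hI : 0 < I.card) (u v : V) (ω : Ω) (hx : 0 < hitCount C I {c | u ∉ c 0} ω)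
    (hy : 0 < hitCount C I {c | u ∉ c 0 ∧ v ∉ c 1} ω) :
    edgeEstimate (fun i => C i ω) I u v =
      (1 - hitCount C I {c | v ∉ c 1} ω / I.card * (hitCount C I {c | u ∉ c 0} ω / I.card) /
        (hitCount C I {c | u ∉ c 0 ∧ v ∉ c 1} ω / I.card)) /
        (hitCount C I {c | u ∈ c 0} ω / I.card) := by
  have hI' : (0 : ℝ) < I.card := by exact_mod_cast hI
  have hcond : 1 - apCondEstimate (fun i => C i ω) I v u =
      hitCount C I {c | u ∉ c 0 ∧ v ∉ c 1} ω / hitCount C I {c | u ∉ c 0} ω := by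
    have h := Finset.card_filter_add_card_filter_not
      (s := I.filter fun i => u ∉ C i ω 0) fun i => v ∈ C i ω 1
    rw [Finset.filter_filter, Finset.filter_filter] at h
    have h' : ((I.filter fun i => u ∉ C i ω 0 ∧ v ∈ C i ω 1).card : ℝ) +
        (I.filter fun i => u ∉ C i ω 0 ∧ v ∉ C i ω 1).card =
        (I.filter fun i => u ∉ C i ω 0).card := by exact_mod_cast h
    have hx2 : hitCount C I {c | u ∉ c 0} ω = ((I.filter fun i => u ∉ C i ω 0).card : ℝ) := by
      rw [hitCount_eq_card]; simp only [Set.mem_ofPred_eq]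
    have hy2 : hitCount C I {c | u ∉ c 0 ∧ v ∉ c 1} ω =
        ((I.filter fun i => u ∉ C i ω 0 ∧ v ∉ C i ω 1).card : ℝ) := by
      rw [hitCount_eq_card]; simp only [Set.mem_ofPred_eq]
    rw [apCondEstimate, hx2, hy2, sub_eq_iff_eq_add, ← add_div, add_comm, h', div_self]
    rw [← hx2]
    exact hx.ne'
  have hseed : seedEstimate (fun i => C i ω) I u = hitCount C I {c | u ∈ c 0} ω / I.card := by
    rw [seedEstimate, hitCount_eq_card]; simp only [Set.mem_ofPred_eq]
  rw [edgeEstimate, hseed, hcond, apEstimate_eq C I hI,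
    show apCondEstimate (fun i => C i ω) I v u =
      1 - hitCount C I {c | u ∉ c 0 ∧ v ∉ c 1} ω / hitCount C I {c | u ∉ c 0} ω by
      rw [← hcond]; ring]
  rw [mul_comm (hitCount C I {c | u ∈ c 0} ω / I.card), ← div_div]
  congr 1
  field_simp
  ring

variable {P : Measure Ω} [IsProbabilityMeasure P]

/-- The edge probabilities into nodes that are not almost surely activated are estimated well. -/
theorem edgeEstimate_error {p : Network V} {q : V → unitInterval} (hn : 2 ≤ Fintype.card V)
    {t : ℕ} {C : Fin t → Ω → Cascade V} (hC : iIndepFun C P)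
    (hlaw : ∀ i, HasLaw (C i) (cascadeLaw p q).toMeasure P) {I : Finset (Fin t)}
    (hI : 0 < I.card) {u v : V} (huv : u ≠ v) {γ β ρ : ℝ} (hγ : 0 < γ) (hγq : γ ≤ q u)
    (hγq' : (q u : ℝ) ≤ 1 - γ) (hβ : 0 < β) (hβ1 : β ≤ 1) (hv : β ≤ missAvg p q v)
    (hρ0 : 0 ≤ ρ) (hρ : ρ ≤ 1 / 10) :
    P.real {ω | ¬ |edgeEstimate (fun i => C i ω) I u v - p u v| ≤ 5 * ρ / γ} ≤
      8 * Real.exp (-(ρ ^ 2 * (I.card * (γ * β)) / 4)) := by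
  set ν := (cascadeLaw p q).toMeasure with hν
  have hI' : (0 : ℝ) < I.card := by exact_mod_cast hI
  have ma : MeasurableSet {c : Cascade V | v ∉ c 1} := measurableSet_first fun _ A => v ∉ A
  have mx : MeasurableSet {c : Cascade V | u ∉ c 0} := measurableSet_first fun S _ => u ∉ S
  have mq : MeasurableSet {c : Cascade V | u ∈ c 0} := measurableSet_first fun S _ => u ∈ S
  have my : MeasurableSet {c : Cascade V | u ∉ c 0 ∧ v ∉ c 1} :=
    measurableSet_first fun S A => u ∉ S ∧ v ∉ A
  have va : ν.real {c | v ∉ c 1} = missAvg p q v := cascadeLaw_miss p q hn v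
  have vx : ν.real {c | u ∉ c 0} = 1 - q u := cascadeLaw_notMem p q hn u
  have vq : ν.real {c | u ∈ c 0} = q u := by
    have h := probReal_compl_eq_one_sub (μ := ν) mx
    rw [vx] at h
    have h2 : {c : Cascade V | u ∉ c 0}ᶜ = {c | u ∈ c 0} := by ext c; simp
    rw [h2] at h
    linarith
  have vy := cascadeLaw_notMem_miss_mul p q hn huv
  rw [← hν] at vy
  have hp0 : (0 : ℝ) ≤ p u v := (p u v).2.1
  have hp1 : (p u v : ℝ) ≤ 1 := (p u v).2.2
  have hγ1 : γ ≤ 1 := hγq.trans (q u).2.2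
  have hγβ : 0 < γ * β := mul_pos hγ hβ
  have hγβγ : γ * β ≤ γ := mul_le_of_le_one_right hγ.le hβ1
  have hγββ : γ * β ≤ β := mul_le_of_le_one_left hβ.le hγ1
  have hax : γ * β ≤ missAvg p q v * (1 - q u) := by
    rw [mul_comm]
    exact mul_le_mul hv (by linarith) hγ.le (hβ.le.trans hv)
  have hy : γ * β ≤ ν.real {c | u ∉ c 0 ∧ v ∉ c 1} := by
    rw [← vy] at hax
    refine hax.trans (mul_le_of_le_one_right measureReal_nonneg ?_)
    have := mul_nonneg (hγ.le.trans hγq) hp0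
    linarith
  -- All four events have probability at least `γ * β`, so one tail bound serves them all; two tails
  -- each give the factor 8.
  have hrel : ∀ B : Set (Cascade V), MeasurableSet B → γ * β ≤ ν.real B →
      P.real {ω | ¬ |hitCount C I B ω / I.card - ν.real B| < ρ * ν.real B} ≤
        2 * Real.exp (-(ρ ^ 2 * (I.card * (γ * β)) / 4)) := by
    intro B hB hBβ
    refine (hitCount_rel hC hlaw I hB hρ0 (by linarith) hI).trans ?_
    gcongr
  have hsub : {ω | ¬ |edgeEstimate (fun i => C i ω) I u v - p u v| ≤ 5 * ρ / γ} ⊆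
      {ω | ¬ |hitCount C I {c | v ∉ c 1} ω / I.card - ν.real {c | v ∉ c 1}| <
        ρ * ν.real {c | v ∉ c 1}} ∪
      ({ω | ¬ |hitCount C I {c | u ∉ c 0} ω / I.card - ν.real {c | u ∉ c 0}| <
        ρ * ν.real {c | u ∉ c 0}} ∪
      ({ω | ¬ |hitCount C I {c | u ∈ c 0} ω / I.card - ν.real {c | u ∈ c 0}| <
        ρ * ν.real {c | u ∈ c 0}} ∪
      {ω | ¬ |hitCount C I {c | u ∉ c 0 ∧ v ∉ c 1} ω / I.card -
          ν.real {c | u ∉ c 0 ∧ v ∉ c 1}| <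
        ρ * ν.real {c | u ∉ c 0 ∧ v ∉ c 1}})) := by
    intro ω hω
    by_contra hcon
    simp only [Set.mem_union, Set.mem_ofPred_eq, not_or, not_not] at hcon
    obtain ⟨h1, h2, h3, h4⟩ := hcon
    have hpos : ∀ B : Set (Cascade V), γ * β ≤ ν.real B →
        |hitCount C I B ω / I.card - ν.real B| < ρ * ν.real B → 0 < hitCount C I B ω := by
      intro B hB h
      have h5 := (abs_lt.1 h).1
      have h6 : 0 < ν.real B := hγβ.trans_le hB
      have h7 : 0 < hitCount C I B ω / I.card := by nlinarith
      by_contra hneg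
      exact absurd h7 (not_lt.2 (div_nonpos_of_nonpos_of_nonneg (not_lt.1 hneg) hI'.le))
    refine hω ?_
    rw [edgeEstimate_eq C I hI u v ω (hpos _ (by rw [vx]; linarith) h2) (hpos _ hy h4)]
    rw [va] at h1
    rw [vx] at h2
    rw [vq] at h3
    exact abs_edge_estimate_sub_le hγ hγq (q u).2.2 hp0 hp1 (hβ.trans_le hv) (by linarith)
      (hγβ.trans_le hy) hρ0 hρ vy h1 h2 h4 h3
  refine (measureReal_mono hsub).trans ?_
  refine (measureReal_union_le _ _).trans ((add_le_add_right ((measureReal_union_le _ _).trans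
    (add_le_add_right (measureReal_union_le _ _) _)) _).trans ?_)
  have := hrel _ ma (by rw [va]; linarith)
  have := hrel _ mx (by rw [vx]; linarith)
  have := hrel _ mq (by rw [vq]; linarith)
  have := hrel _ my hy
  linarith

/-- The one-step activation test separates nodes with large and small miss probability. -/
theorem apEstimate_test_error {p : Network V} {q : V → unitInterval} (hn : 2 ≤ Fintype.card V)
    {t : ℕ} {C : Fin t → Ω → Cascade V} (hC : iIndepFun C P)
    (hlaw : ∀ i, HasLaw (C i) (cascadeLaw p q).toMeasure P) {I : Finset (Fin t)}
    (hI : 0 < I.card) (v : V) {β : ℝ} (hβ : 0 ≤ β) :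
    P.real {ω | ¬ ((1 - β / 4 ≤ apEstimate (fun i => C i ω) I v → missAvg p q v ≤ β / 3) ∧
        (¬ 1 - β / 4 ≤ apEstimate (fun i => C i ω) I v → β / 6 ≤ missAvg p q v))} ≤
      Real.exp (-(I.card * β / 192)) := by
  have hI' : (0 : ℝ) < I.card := by exact_mod_cast hI
  have ma : MeasurableSet {c : Cascade V | v ∉ c 1} := measurableSet_first fun _ A => v ∉ A
  have va := cascadeLaw_miss p q hn v
  -- Between `β / 6` and `β / 3` both answers of the test are right. Below, the frequency must
  -- overshoot by the factor 3/2 to reach `β / 4`; above, undershoot by 3/4, which gives the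
  -- constant 192.
  by_cases h1 : missAvg p q v ≤ β / 3
  · by_cases h2 : β / 6 ≤ missAvg p q v
    · simp only [h1, h2, implies_true, and_self, not_true_eq_false, Set.ofPred_false,
        measureReal_empty]
      positivity
    · have h := hitCount_upper hC hlaw I ma (K := I.card * (β / 6)) (ρ := 1 / 2) (by norm_num)
        (by norm_num) (by rw [va]; exact mul_le_mul_of_nonneg_left (not_le.1 h2).le hI'.le)
      refine (measureReal_mono ?_).trans (h.trans (Real.exp_le_exp.2 ?_))
      · intro ω hω
        simp only [h1, h2, implies_true, true_and, imp_false, not_not, Set.mem_ofPred_eq,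
          apEstimate_eq C I hI, not_le] at hω ⊢
        have h3 : β / 4 < hitCount C I {c | v ∉ c 1} ω / I.card := by linarith
        rw [lt_div_iff₀ hI'] at h3
        linarith
      · nlinarith [mul_nonneg hI'.le hβ]
  · have h2 : β / 6 ≤ missAvg p q v := by linarith
    have h := hitCount_lower hC hlaw I ma (K := I.card * (β / 3)) (ρ := 1 / 4) (by norm_num)
      (by norm_num) (by positivity)
      (by rw [va]; exact mul_le_mul_of_nonneg_left (not_le.1 h1).le hI'.le)
    refine (measureReal_mono ?_).trans (h.trans (Real.exp_le_exp.2 ?_))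
    · intro ω hω
      simp only [h1, h2, implies_true, and_true, imp_false, not_not, Set.mem_ofPred_eq,
        apEstimate_eq C I hI] at hω ⊢
      have h3 : hitCount C I {c | v ∉ c 1} ω / I.card ≤ β / 4 := by linarith
      rw [div_le_iff₀ hI'] at h3
      linarith
    · nlinarith [mul_nonneg hI'.le hβ]

end Estimation

/-! ### Deterministic guarantee outside the bad events -/

section Guarantee

variable {V : Type*} [Fintype V] [DecidableEq V]

theorem imsOutput_guarantee {p : Network V} {k : ℕ} (hk : 1 ≤ k) (hkn : k ≤ Fintype.card V)
    {ε δ κ : ℝ} (hε : 0 < ε) (hε' : ε < 1 / 3) (hκ : 0 < κ) (hκ' : κ ≤ 1)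
    (hεk : 3 ≤ ε * k) {t t' : ℕ} [NeZero t] {A : Network V → ℕ → Finset V}
    (hA : IsApproxAlgorithm κ A) {S : Finset V} (hS : IsOptimalSeedSet p k S)
    {c : Fin t → Cascade V} {W : Finset V} (hcard : ((c 0 0).card : ℝ) ≤ 2 * (ε * k))
    (hW : ∀ v, 1 - δ / (4 * (Fintype.card V : ℝ)) ≤
      apEstimate c (Finset.univ.filter fun i => (i : ℕ) < t') v → v ∈ W)
    (hest : ∀ u v, u ≠ v → ¬ 1 - δ / (4 * (Fintype.card V : ℝ)) ≤
      apEstimate c (Finset.univ.filter fun i => (i : ℕ) < t') v →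
      |edgeEstimate c (Finset.univ.filter fun i => t' ≤ (i : ℕ)) u v - p u v| ≤
        ε * k / (6 * (Fintype.card V : ℝ) ^ 3))
    (hloss : ∀ (p' : Network V) (T : Finset V), (∀ u v, v ∉ W → p' u v = p u v) →
      spread p' T ≤ spread p (T ∪ c 0 0) + ε * k / 3) :
    (imsOutput A c t' k ε δ).card ≤ k ∧
      (κ - 3 * ε) * spread p S ≤ spread p (imsOutput A c t' k ε δ) := by
  have hk0 : (0 : ℝ) < k := by exact_mod_cast hk
  have hn0 : (0 : ℝ) < Fintype.card V := by exact_mod_cast hk.trans hkn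
  set m := ⌊(1 - 2 * ε) * (k : ℝ)⌋₊ with hm
  have hmle : (m : ℝ) ≤ (1 - 2 * ε) * k :=
    Nat.floor_le (mul_nonneg (by linarith) hk0.le)
  have hmgt : (1 - 2 * ε) * k < m + 1 := Nat.lt_floor_add_one _
  have hmk : m ≤ k := by
    have : (m : ℝ) ≤ k := by nlinarith
    exact_mod_cast this
  have hm1 : 1 ≤ m := by
    refine Nat.le_floor ?_
    have h := mul_le_mul_of_nonneg_right hε'.le hk0.le
    push_cast
    linarith
  set L := learnedNetwork c t' δ with hL
  obtain ⟨hAcard, hAopt⟩ := hA L m hm1 (hmk.trans hkn)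
  set T₁ := A L m with hT₁
  have hout : imsOutput A c t' k ε δ = T₁ ∪ c 0 0 := rfl
  rw [hout]
  constructor
  · have h1 : ((T₁ ∪ c 0 0).card : ℝ) ≤ T₁.card + (c 0 0).card := by
      exact_mod_cast Finset.card_union_le _ _
    have h2 : (T₁.card : ℝ) ≤ m := by exact_mod_cast hAcard
    have h3 : ((T₁ ∪ c 0 0).card : ℝ) ≤ k := by linarith
    exact_mod_cast h3
  classical
  -- The intermediate network: true probabilities, except that the edges into the detected nodes are
  -- raised to 1.
  let p' : Network V := fun u v =>
    if 1 - δ / (4 * (Fintype.card V : ℝ)) ≤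
      apEstimate c (Finset.univ.filter fun i => (i : ℕ) < t') v then 1 else p u v
  have hp'W : ∀ u v, v ∉ W → p' u v = p u v := fun u v hv => if_neg fun h => hv (hW v h)
  have hpp' : ∀ u v, p u v ≤ p' u v := by
    intro u v
    simp only [p']
    split_ifs
    · exact (p u v).2.2
    · exact le_rfl
  set η := ε * k / (6 * (Fintype.card V : ℝ) ^ 3) with hη
  have hη0 : 0 ≤ η := by positivity
  have hclose : ∀ u v, u ≠ v → |(L u v : ℝ) - p' u v| ≤ η := by
    intro u v huv
    simp only [hL, learnedNetwork, p']
    split_ifs with h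
    · simpa using hη0
    · refine le_trans ?_ (hest u v huv h)
      -- Truncation is 1-Lipschitz and fixes the true probability, so it does not increase the
      -- error.
      have hp : Set.projIcc (0 : ℝ) 1 zero_le_one (p u v : ℝ) = p u v := Set.projIcc_val _ _
      conv_lhs => rw [← hp]
      exact Set.abs_projIcc_sub_projIcc zero_le_one
  have hΔ : (Fintype.card V : ℝ) ^ 3 * η = ε * k / 6 := by
    rw [hη]
    field_simp
  have hclose' : ∀ u v, u ≠ v → |(p' u v : ℝ) - L u v| ≤ η := fun u v huv => by
    rw [abs_sub_comm]
    exact hclose u v huv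
  obtain ⟨S', hS'card, hS'⟩ : ∃ S' : Finset V, S'.card ≤ m ∧
      (m : ℝ) * spread p S ≤ k * spread p S' := by
    rcases le_total S.card m with h | h
    · exact ⟨S, h, mul_le_mul_of_nonneg_right (by exact_mod_cast hmk) (spread_nonneg _ _)⟩
    · obtain ⟨S', _, hc, hle⟩ := exists_subset_spread p m S h
      exact ⟨S', hc.le, hle.trans (mul_le_mul_of_nonneg_right (by exact_mod_cast hS.1)
        (spread_nonneg _ _))⟩
  have hσk : (k : ℝ) ≤ spread p S := by
    obtain ⟨T, hT, hTk⟩ := Finset.exists_subset_card_eq (s := (Finset.univ : Finset V)) hkn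
    have := card_le_spread p T
    rw [hTk] at this
    exact this.trans (hS.2 T hTk.le)
  have h1 := hloss p' T₁ hp'W
  have h2 := spread_le_add_of_close hη0 hclose T₁
  have h3 := hAopt S' hS'card
  have h4 := spread_le_add_of_close hη0 hclose' S'
  have h5 := spread_mono hpp' (Finset.Subset.refl S')
  rw [hΔ] at h2 h4
  have h6 : κ * (spread p S' - ε * k / 6) ≤ κ * spread L S' :=
    mul_le_mul_of_nonneg_left (by linarith) hκ.le
  -- Rounding the budget down loses less than one seed, and `1 ≤ ε * k / 3`.
  have h7 : (1 - 2 * ε - ε / 3) * spread p S ≤ spread p S' := by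
    refine le_of_mul_le_mul_left ?_ hk0
    refine le_trans ?_ hS'
    rw [← mul_assoc]
    refine mul_le_mul_of_nonneg_right ?_ (spread_nonneg _ _)
    linarith
  have h8 := mul_le_mul_of_nonneg_left h7 hκ.le
  have hσ0 := spread_nonneg p S
  have h9 : κ * (ε * k / 6) ≤ ε * k / 6 := mul_le_of_le_one_left (by positivity) hκ'
  have h10 : κ * (ε * spread p S) ≤ ε * spread p S :=
    mul_le_of_le_one_left (mul_nonneg hε.le hσ0) hκ'
  have h11 : ε * k ≤ ε * spread p S := mul_le_mul_of_nonneg_left hσk hε.le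
  linarith

theorem one_le_log {x : ℝ} (hx : 3 ≤ x) : 1 ≤ Real.log x := by
  rw [Real.le_log_iff_exp_le (by linarith)]
  linarith [Real.exp_one_lt_d9]

theorem card_filter_le_val {t t' : ℕ} (h : t' ≤ t) :
    (Finset.univ.filter fun i : Fin t => t' ≤ (i : ℕ)).card = t - t' := by
  have h1 := Finset.card_filter_add_card_filter_not (s := (Finset.univ : Finset (Fin t)))
    fun i => (i : ℕ) < t'
  simp only [not_lt, Fin.card_filter_val_lt, Finset.card_univ, Fintype.card_fin] at h1
  omega

end Guarantee

end InfluenceMax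

end

/-! ### Choice of the parameters and union bound -/

open InfluenceMax

theorem mainTheorem6 {V : Type*} [Fintype V] [DecidableEq V]
    (p : Network V) (q : V → unitInterval) (k : ℕ) (hk : 1 ≤ k) (hkn : k ≤ Fintype.card V)
    (ε γ δ κ : ℝ) (hε : 0 < ε) (hε' : ε < 1 / 3) (hγ : 0 < γ) (hγ' : γ ≤ 1 / 2)
    (hδ : 0 < δ) (hδ' : δ < 1) (hκ : 0 < κ) (hκ' : κ ≤ 1)
    (hq : SeedAssumption q k ε γ)
    (hkε : 3 / ε * Real.log (3 / δ) ≤ (k : ℝ))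
    (t t' : ℕ) [NeZero t]
    (ht' : t' = ⌈72 * (Fintype.card V : ℝ) ^ 2 / δ ^ 2 *
      Real.log (12 * (Fintype.card V : ℝ) / δ)⌉₊)
    (ht : 36864 / (ε ^ 2 * δ ^ 2 * γ ^ 3) * ((Fintype.card V : ℝ) ^ 8 / (k : ℝ) ^ 2) *
        Real.log (36 * (Fintype.card V : ℝ) / δ) +
      72 * (Fintype.card V : ℝ) ^ 2 / δ ^ 2 *
        Real.log (12 * (Fintype.card V : ℝ) / δ) ≤ (t : ℝ))
    (A : Network V → ℕ → Finset V) (hA : IsApproxAlgorithm κ A)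
    {Ω : Type*} [MeasurableSpace Ω] (P : Measure Ω) [IsProbabilityMeasure P]
    (C : Fin t → Ω → Cascade V) (hC : iIndepFun C P)
    (hlaw : ∀ i, HasLaw (C i) (cascadeLaw p q).toMeasure P)
    (S : Finset V) (hS : IsOptimalSeedSet p k S) :
    1 - δ ≤ P.real {ω |
      (imsOutput A (fun i => C i ω) t' k ε δ).card ≤ k ∧
      (κ - 3 * ε) * spread p S ≤ spread p (imsOutput A (fun i => C i ω) t' k ε δ)} := by
  have hk0 : (0 : ℝ) < k := by exact_mod_cast hk
  set x : ℝ := (Fintype.card V : ℝ) with hx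
  have hkx : (k : ℝ) ≤ x := by
    rw [hx]
    exact_mod_cast hkn
  have hlogδ : 1 ≤ Real.log (3 / δ) := one_le_log (by rw [le_div_iff₀ hδ]; linarith)
  have hεklog : 3 * Real.log (3 / δ) ≤ ε * k := by
    have := mul_le_mul_of_nonneg_left hkε hε.le
    rwa [← mul_assoc, mul_div_cancel₀ _ hε.ne'] at this
  have hεk : 3 ≤ ε * k := by linarith
  have hk9 : (9 : ℝ) ≤ k := by nlinarith
  have hx9 : 9 ≤ x := hk9.trans hkx
  have hx0 : 0 < x := by linarith
  have hn : 2 ≤ Fintype.card V := by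
    have : (2 : ℝ) ≤ x := by linarith
    rw [hx] at this
    exact_mod_cast this
  have hxδ : 9 ≤ x / δ := by
    rw [le_div_iff₀ hδ]
    linarith
  set L₁ := Real.log (12 * x / δ) with hL₁
  set L₂ := Real.log (36 * x / δ) with hL₂
  have hL₁1 : 1 ≤ L₁ := one_le_log (by rw [mul_div_assoc]; linarith)
  have hL₂1 : 1 ≤ L₂ := one_le_log (by rw [mul_div_assoc]; linarith)
  set D := x ^ 8 / (ε ^ 2 * δ ^ 2 * γ ^ 3 * (k : ℝ) ^ 2) with hD
  have hD1 : 1 ≤ D := by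
    rw [hD, le_div_iff₀ (by positivity), one_mul]
    have h1 : ε ^ 2 ≤ 1 := pow_le_one₀ hε.le (by linarith)
    have h2 : δ ^ 2 ≤ 1 := pow_le_one₀ hδ.le hδ'.le
    have h3 : γ ^ 3 ≤ 1 := pow_le_one₀ hγ.le (by linarith)
    calc ε ^ 2 * δ ^ 2 * γ ^ 3 * (k : ℝ) ^ 2 ≤ 1 * 1 * 1 * x ^ 2 := by gcongr
      _ = x ^ 2 := by ring
      _ ≤ x ^ 8 := pow_le_pow_right₀ (by linarith) (by norm_num)
  have hDL : 1 ≤ D * L₂ := one_le_mul_of_one_le_of_one_le hD1 hL₂1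
  set Q := 72 * x ^ 2 / δ ^ 2 * L₁ with hQ
  have hQ0 : 0 < Q := by positivity
  have hbig : 36864 / (ε ^ 2 * δ ^ 2 * γ ^ 3) * (x ^ 8 / (k : ℝ) ^ 2) * L₂ =
      36864 * (D * L₂) := by
    rw [hD]
    field_simp
  rw [hbig] at ht
  have ht'Q : Q ≤ t' := ht' ▸ Nat.le_ceil Q
  have ht'Q1 : (t' : ℝ) < Q + 1 := ht' ▸ Nat.ceil_lt_add_one hQ0.le
  have htt' : t' ≤ t := by
    have : (t' : ℝ) ≤ t := by linarith
    exact_mod_cast this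
  set I₁ := Finset.univ.filter fun i : Fin t => (i : ℕ) < t' with hI₁
  set I₂ := Finset.univ.filter fun i : Fin t => t' ≤ (i : ℕ) with hI₂
  have hI₁card : I₁.card = t' := by
    rw [hI₁, Fin.card_filter_val_lt]
    omega
  have hI₂card : (I₂.card : ℝ) = t - t' := by
    rw [hI₂, card_filter_le_val htt', Nat.cast_sub htt']
  have hI₁pos : 0 < I₁.card := by
    rw [hI₁card]
    have : (0 : ℝ) < t' := by linarith
    exact_mod_cast this
  -- The drop from 36864 to 36000 absorbs the rounding of `t'`.
  have hI₂ge : 36000 * (D * L₂) ≤ I₂.card := by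
    rw [hI₂card]
    linarith
  have hI₂pos : 0 < I₂.card := by
    have : (0 : ℝ) < I₂.card := by linarith
    exact_mod_cast this
  -- `W` is defined by the true miss probabilities, so it is not random, unlike the detected set,
  -- which depends on the first cascade.
  set W := Finset.univ.filter fun v => missAvg p q v ≤ δ / x / 3 with hW
  obtain ⟨α, hα, hα1, hαloss⟩ := exists_loss_weights p W
  -- the four bad events
  let B₁ : Set Ω := {ω | 2 * (ε * k) < ((C 0 ω 0).card : ℝ)}
  let B₂ : Set Ω := {ω | ε * k / 3 ≤ ∑ w, ∑ v ∈ W, α w v * missProb p (C 0 ω 0) v}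
  let B₃ : V → Set Ω := fun v =>
    {ω | ¬ ((1 - δ / x / 4 ≤ apEstimate (fun i => C i ω) I₁ v → missAvg p q v ≤ δ / x / 3) ∧
      (¬ 1 - δ / x / 4 ≤ apEstimate (fun i => C i ω) I₁ v → δ / x / 6 ≤ missAvg p q v))}
  let R : Finset (V × V) :=
    Finset.univ.filter fun e => e.1 ≠ e.2 ∧ δ / x / 6 ≤ missAvg p q e.2
  -- Chosen so that the edge error `5 * ρ / γ` is `ε * k / (6 * x ^ 3)`.
  set ρ := γ * (ε * k) / (30 * x ^ 3) with hρ
  have hργ : 5 * ρ / γ = ε * k / (6 * x ^ 3) := by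
    rw [hρ]
    field_simp
    norm_num
  let B₄ : V × V → Set Ω := fun e =>
    {ω | ¬ |edgeEstimate (fun i => C i ω) I₂ e.1 e.2 - p e.1 e.2| ≤ 5 * ρ / γ}
  have hB₁ : P.real B₁ ≤ δ / 3 := by
    have h1 := (hlaw 0).measureReal_eq (p := fun c => 2 * (ε * k) < ((c 0).card : ℝ))
      (measurableSet_first fun S _ => 2 * (ε * k) < (S.card : ℝ))
    refine (le_of_eq h1).trans ((cascadeLaw_card_seed_le p q hn hq.1 (by positivity)).trans ?_)
    calc Real.exp (-(ε * k / 3)) ≤ Real.exp (-Real.log (3 / δ)) :=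
          Real.exp_le_exp.2 (by linarith)
      _ = δ / 3 := by rw [Real.exp_neg, Real.exp_log (by positivity), inv_div]
  have hB₂ : P.real B₂ ≤ δ / 3 := by
    have h1 := (hlaw 0).measureReal_eq
      (p := fun c => ε * k / 3 ≤ ∑ w, ∑ v ∈ W, α w v * missProb p (c 0) v)
      (measurableSet_first fun S _ => ε * k / 3 ≤ ∑ w, ∑ v ∈ W, α w v * missProb p S v)
    refine (le_of_eq h1).trans ((cascadeLaw_loss_le p q hn W α hα hα1 (β := δ / x / 3)
      (by positivity) (fun v hv => (Finset.mem_filter.1 hv).2) (by positivity)).trans ?_)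
    rw [div_le_iff₀ (by positivity)]
    have h2 : x * (δ / x / 3) = δ / 3 := by field_simp
    rw [← hx, h2]
    exact le_mul_of_one_le_right (by positivity) (by linarith)
  have hB₃ : P.real (⋃ v ∈ Finset.univ, B₃ v) ≤ δ / 6 := by
    refine (measureReal_biUnion_finset_le _ _).trans ?_
    have h1 : ∀ v, P.real (B₃ v) ≤ δ / (12 * x) := by
      intro v
      refine (apEstimate_test_error hn hC hlaw hI₁pos v (β := δ / x) (by positivity)).trans ?_
      have h2 : L₁ ≤ I₁.card * (δ / x) / 192 := by
        rw [hI₁card]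
        have h3 : Q * (δ / x) = 72 * (x / δ) * L₁ := by
          rw [hQ]
          field_simp
        have h4 : Q * (δ / x) ≤ t' * (δ / x) := mul_le_mul_of_nonneg_right ht'Q (by positivity)
        have h5 : 9 * L₁ ≤ x / δ * L₁ := mul_le_mul_of_nonneg_right hxδ (by linarith)
        linarith
      calc Real.exp (-(I₁.card * (δ / x) / 192)) ≤ Real.exp (-L₁) := Real.exp_le_exp.2 (by linarith)
        _ = δ / (12 * x) := by rw [hL₁, Real.exp_neg, Real.exp_log (by positivity), inv_div]
    calc ∑ v, P.real (B₃ v) ≤ ∑ v : V, δ / (12 * x) := Finset.sum_le_sum fun v _ => h1 v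
      _ = x * (δ / (12 * x)) := by rw [Finset.sum_const, nsmul_eq_mul, Finset.card_univ]
      _ = δ / 12 := by field_simp
      _ ≤ δ / 6 := by linarith
  have hρ0 : 0 ≤ ρ := by positivity
  have hρ1 : ρ ≤ 1 / 10 := by
    rw [hρ, div_le_iff₀ (by positivity)]
    have h1 : γ * (ε * k) ≤ 1 * (1 * x) := by
      gcongr <;> linarith
    have h2 : x ≤ x ^ 3 := le_self_pow₀ (by linarith) (by norm_num)
    linarith
  have hB₄ : P.real (⋃ e ∈ R, B₄ e) ≤ δ / 6 := by
    refine (measureReal_biUnion_finset_le _ _).trans ?_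
    have h1 : ∀ e ∈ R, P.real (B₄ e) ≤ 8 * (δ / (36 * x)) ^ 2 := by
      intro e he
      obtain ⟨hne, hmiss⟩ := (Finset.mem_filter.1 he).2
      refine (edgeEstimate_error hn hC hlaw hI₂pos hne hγ (hq.2 e.1).1 (hq.2 e.1).2
        (β := δ / x / 6) (by positivity) ?_ hmiss hρ0 hρ1).trans ?_
      · rw [div_div, div_le_one (by positivity)]
        linarith
      -- The factor 2 squares `δ / (36 * x)`, which pays for the union bound over at most `x ^ 2`
      -- pairs.
      · have h2 : 2 * L₂ ≤ ρ ^ 2 * (I₂.card * (γ * (δ / x / 6))) / 4 := by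
          have h3 : ρ ^ 2 * (36000 * (D * L₂) * (γ * (δ / x / 6))) / 4 =
              5 / 3 * (x / δ) * L₂ := by
            rw [hρ, hD]
            field_simp
            norm_num
          have h4 : ρ ^ 2 * (36000 * (D * L₂) * (γ * (δ / x / 6))) / 4 ≤
              ρ ^ 2 * (I₂.card * (γ * (δ / x / 6))) / 4 := by gcongr
          have h5 : 9 * L₂ ≤ x / δ * L₂ := mul_le_mul_of_nonneg_right hxδ (by linarith)
          linarith
        have h6 : Real.exp (-L₂) = δ / (36 * x) := by
          rw [hL₂, Real.exp_neg, Real.exp_log (by positivity), inv_div]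
        rw [← h6, ← Real.exp_nat_mul]
        gcongr
        push_cast
        linarith
    calc ∑ e ∈ R, P.real (B₄ e) ≤ ∑ e ∈ R, 8 * (δ / (36 * x)) ^ 2 := Finset.sum_le_sum h1
      _ ≤ ∑ e : V × V, 8 * (δ / (36 * x)) ^ 2 :=
        Finset.sum_le_sum_of_subset_of_nonneg (Finset.filter_subset _ _) fun _ _ _ => by positivity
      _ = x ^ 2 * (8 * (δ / (36 * x)) ^ 2) := by
        rw [Finset.sum_const, nsmul_eq_mul, Finset.card_univ, Fintype.card_prod, Nat.cast_mul, ← hx]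
        ring
      _ = 8 / 1296 * (δ * δ) := by
        field_simp
        norm_num
      _ ≤ 8 / 1296 * (δ * 1) := by gcongr
      _ ≤ δ / 6 := by linarith
  have hcover : (Set.univ : Set Ω) ⊆ {ω |
      (imsOutput A (fun i => C i ω) t' k ε δ).card ≤ k ∧
      (κ - 3 * ε) * spread p S ≤ spread p (imsOutput A (fun i => C i ω) t' k ε δ)} ∪
      (B₁ ∪ (B₂ ∪ ((⋃ v ∈ Finset.univ, B₃ v) ∪ ⋃ e ∈ R, B₄ e))) := by
    intro ω _
    by_contra hcon
    simp only [Set.mem_union, not_or, Set.mem_iUnion, not_exists, Finset.mem_univ] at hcon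
    obtain ⟨hgood, hb₁, hb₂, hb₃, hb₄⟩ := hcon
    have hx4 : δ / (4 * (Fintype.card V : ℝ)) = δ / x / 4 := by rw [← hx, div_div, mul_comm]
    have hb₃' : ∀ v, (1 - δ / x / 4 ≤ apEstimate (fun i => C i ω) I₁ v →
        missAvg p q v ≤ δ / x / 3) ∧
        (¬ 1 - δ / x / 4 ≤ apEstimate (fun i => C i ω) I₁ v → δ / x / 6 ≤ missAvg p q v) :=
      fun v => not_not.1 (hb₃ v trivial)
    refine hgood (imsOutput_guarantee (W := W) hk hkn hε hε' hκ hκ' hεk hA hS ?_ ?_ ?_ ?_)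
    · exact not_lt.1 hb₁
    · intro v hv
      rw [hx4] at hv
      exact Finset.mem_filter.2 ⟨Finset.mem_univ v, (hb₃' v).1 hv⟩
    · intro u v huv hv
      rw [hx4] at hv
      have h := not_not.1 (hb₄ (u, v) (Finset.mem_filter.2
        ⟨Finset.mem_univ _, huv, (hb₃' v).2 hv⟩))
      rw [hργ] at h
      exact h
    · intro p' T hp'
      exact (hαloss p' T (C 0 ω 0) hp').trans
        (add_le_add_right (not_le.1 hb₂).le _)
  have h := measureReal_mono (μ := P) hcover
  rw [probReal_univ] at h
  have h1 := h.trans (measureReal_union_le _ _)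
  have h2 := measureReal_union_le (μ := P) B₁ (B₂ ∪ ((⋃ v ∈ Finset.univ, B₃ v) ∪ ⋃ e ∈ R, B₄ e))
  have h3 := measureReal_union_le (μ := P) B₂ ((⋃ v ∈ Finset.univ, B₃ v) ∪ ⋃ e ∈ R, B₄ e)
  have h4 := measureReal_union_le (μ := P) (⋃ v ∈ Finset.univ, B₃ v) (⋃ e ∈ R, B₄ e)
  linarith
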